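/- Let $n\ge 1$. Write $(x,y)$, $x\in\mathbb{R}$, $y=(y_1,\dots,y_n)\in\mathbb{R}^n$, for the linear coordinates on $\mathbb{R}^{n+1}$, and let $\langle\cdot,\cdot\rangle$, $\|\cdot\|$ be the standard Euclidean scalar product and norm on $\mathbb{R}^n$. Let $\mathrm{Sym}^3(\mathbb{R}^{m})^*$ be the finite-dimensional vector space of homogeneous cubic polynomials on $\mathbb{R}^{m}$ with its usual topology. **Definitions.** A point $p\in\mathbb{R}^{n+1}$ is a *hyperbolic point* of a homogeneous cubic polynomial $h$ if $h(p)>0$ and $-\partial^2h_p$ has signature $(n,1)$; $h$ is *hyperbolic* if it has a hyperbolic point. An $n$-dimensional *closed connected projective special real (CCPSR) manifold* is a closed connected nonempty subset $\mathcal{H}\subset\mathbb{R}^{n+1}$ that is an open subset of the level set $\{h=1\}$ of a hyperbolic homogeneous cubic polynomial $h$ and consists only of hyperbolic points of $h$. Two such manifolds $\mathcal{H}\subset\{h=1\}$ and $\mathcal{H}'\subset\{h'=1\}$ are *equivalent* if there is $A\in\mathrm{GL}(n+1)$ with $h\circ A=h'$ and $A(\mathcal{H}')=\mathcal{H}$.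 With $U=\mathbb{R}_{>0}\cdot\mathcal{H}$, the manifold $\mathcal{H}\subset\{h=1\}$ has *regular boundary behaviour* if for all $p\in\partial U\setminus\{0\}$ one has $dh_p\neq 0$, and the restriction of $-\partial^2h_p$ to $T_p(\partial U\setminus\{0\})=\ker dh_p$ is positive semi-definite with kernel of dimension $1$. Put $$\mathcal{A}_n=\left\{x^3-x\langle y,y\rangle+P_3(y)\ \middle|\ P_3\in\mathrm{Sym}^3(\mathbb{R}^n)^*\right\}\subset\mathrm{Sym}^3(\mathbb{R}^{n+1})^*,$$ $$\mathcal{C}_n=\left\{x^3-x\langle y,y\rangle+P_3(y)\in\mathcal{A}_n\ \middle|\ \max_{\|y\|=1}P_3(y)\le\frac{2}{3\sqrt3}\right\},$$ and let $\partial\mathcal{C}_n$ be the boundary of $\mathcal{C}_n$ as a subset of $\mathcal{A}_n$. **Theorem.** 1. For every $n$-dimensional CCPSR manifold $\mathcal{H}$ there is $\widetilde h\in\mathcal{C}_n$ such that $\mathcal{H}$ is equivalent to the connected component of $\{\widetilde h=1\}$ that contains the point $(1,0)$. 2. Conversely, for every $h\in\mathcal{C}_n$ the polynomial $h$ is hyperbolic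 and the connected component of $\{h=1\}$ that contains $(1,0)$ is a CCPSR manifold. 3. $\mathcal{A}_n$ is an affine subspace of $\mathrm{Sym}^3(\mathbb{R}^{n+1})^*$ of dimension $\frac{n^3+3n^2+2n}{6}$, and $\mathcal{C}_n\subset\mathcal{A}_n$ is bounded, compact and convex. 4. $\partial\mathcal{C}_n$ is a continuous (that is, locally flat topological) submanifold of $\mathrm{Sym}^3(\mathbb{R}^{n+1})^*$ of dimension $\frac{n^3+3n^2+2n}{6}-1$, and a continuous hypersurface of $\mathcal{A}_n$. 5. Whenever $\mathcal{H}$ is a CCPSR manifold and $\widetilde h\in\mathcal{C}_n$ is such that $\mathcal{H}$ is equivalent to the connected component of $\{\widetilde h=1\}$ containing $(1,0)$, then $\widetilde h\in\partial\mathcal{C}_n$ if and only if $\mathcal{H}$ does not have regular boundary behaviour. -/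

import Mathlib

open Set Module

noncomputable section

/-- `ℝⁿ⁺¹` with its linear coordinates `(x, y)`, where `x ∈ ℝ` and `y ∈ ℝⁿ`; the second factor
carries the standard Euclidean scalar product. -/
abbrev Ambient (n : ℕ) : Type := ℝ × EuclideanSpace ℝ (Fin n)

/-- `Sym³(E)^*`: the symmetric trilinear forms on `E`, i.e. the homogeneous cubic polynomials on
`E` (see `cubicEval`). It carries the topology of a (finite dimensional, if `E` is) normed space. -/
def cubicSubmodule (E : Type*) [NormedAddCommGroup E] [NormedSpace ℝ E] :
    Submodule ℝ (ContinuousMultilinearMap ℝ (fun _ : Fin 3 => E) ℝ) where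
  carrier := {f | ∀ (σ : Equiv.Perm (Fin 3)) (v : Fin 3 → E), f (fun i => v (σ i)) = f v}
  add_mem' := by
    intro f g hf hg σ v
    simp [hf σ v, hg σ v]
  zero_mem' := by
    intro σ v
    simp
  smul_mem' := by
    intro c f hf σ v
    simp [hf σ v]

abbrev CubicForm (E : Type*) [NormedAddCommGroup E] [NormedSpace ℝ E] : Type _ :=
  ↥(cubicSubmodule E)

instance {E : Type*} [NormedAddCommGroup E] [NormedSpace ℝ E] : AddCommGroup (CubicForm E) :=
  Submodule.addCommGroup _

instance {E : Type*} [NormedAddCommGroup E] [NormedSpace ℝ E] : NormedAddCommGroup (CubicForm E) :=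
  Submodule.normedAddCommGroup _

/-- The homogeneous cubic polynomial `v ↦ h(v, v, v)` given by `h ∈ Sym³(E)^*`. -/
def cubicEval {E : Type*} [NormedAddCommGroup E] [NormedSpace ℝ E] (h : CubicForm E) : E → ℝ :=
  fun v => (h : ContinuousMultilinearMap ℝ (fun _ : Fin 3 => E) ℝ) (fun _ => v)

/-- The bilinear form `-∂²f_p`. -/
def negHessian {E : Type*} [NormedAddCommGroup E] [NormedSpace ℝ E] (f : E → ℝ) (p : E) :
    LinearMap.BilinForm ℝ E :=
  -(fderiv ℝ (fderiv ℝ f) p).toLinearMap₁₂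

/-- `p` is a hyperbolic point of `f`: `f(p) > 0` and `-∂²f_p` has signature `(n, 1)`. -/
def IsHyperbolicPoint {n : ℕ} (f : Ambient n → ℝ) (p : Ambient n) : Prop :=
  0 < f p ∧ sigPos (negHessian f p).toQuadraticMap = n ∧
    sigNeg (negHessian f p).toQuadraticMap = 1

def IsHyperbolic {n : ℕ} (h : CubicForm (Ambient n)) : Prop :=
  ∃ p, IsHyperbolicPoint (cubicEval h) p

/-- `H ⊆ {h = 1}` is an `n`-dimensional PSR manifold: a (relatively) open subset of the level set
`{h = 1}` of a hyperbolic homogeneous cubic polynomial, consisting only of hyperbolic points. -/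
structure IsPSR {n : ℕ} (h : CubicForm (Ambient n)) (H : Set (Ambient n)) : Prop where
  hyperbolic : IsHyperbolic h
  isOpen_in_level : ∃ O : Set (Ambient n), IsOpen O ∧ H = O ∩ {p | cubicEval h p = 1}
  hyperbolic_points : ∀ p ∈ H, IsHyperbolicPoint (cubicEval h) p

/-- Closed connected PSR manifolds. -/
structure IsCCPSR {n : ℕ} (h : CubicForm (Ambient n)) (H : Set (Ambient n)) : Prop
    extends IsPSR h H where
  isClosed : IsClosed H
  isConnected : IsConnected H

/-- Equivalence of `H ⊆ {h = 1}` and `H' ⊆ {h' = 1}` under `GL(n+1)`. -/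
def PSREquivalent {n : ℕ} (h : CubicForm (Ambient n)) (H : Set (Ambient n))
    (h' : CubicForm (Ambient n)) (H' : Set (Ambient n)) : Prop :=
  ∃ A : Ambient n ≃ₗ[ℝ] Ambient n, (∀ p, cubicEval h (A p) = cubicEval h' p) ∧ A '' H' = H

/-- The cone `ℝ_{>0} · H`. -/
def posCone {n : ℕ} (H : Set (Ambient n)) : Set (Ambient n) :=
  {q | ∃ r : ℝ, 0 < r ∧ ∃ p ∈ H, q = r • p}

/-- Regular boundary behaviour of a closed connected PSR manifold `H ⊆ {h = 1}`, with
`U = ℝ_{>0} · H`. Where `dh_p ≠ 0`, the boundary `∂U` is near `p` the hypersurface `{h = 0}`, and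
its tangent space `T_p(∂U)` is `ker dh_p`. -/
def HasRegularBoundary {n : ℕ} (h : CubicForm (Ambient n)) (H : Set (Ambient n)) : Prop :=
  ∀ p ∈ frontier (posCone H), p ≠ 0 →
    fderiv ℝ (cubicEval h) p ≠ 0 ∧
    (∀ v ∈ (fderiv ℝ (cubicEval h) p).ker, 0 ≤ negHessian (cubicEval h) p v v) ∧
    finrank ℝ (LinearMap.ker
      ((negHessian (cubicEval h) p).restrict (fderiv ℝ (cubicEval h) p).ker)) = 1

/-- `h = x³ - x⟨y, y⟩ + P(y)`. -/
def IsStandardForm {n : ℕ} (h : CubicForm (Ambient n))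
    (P : CubicForm (EuclideanSpace ℝ (Fin n))) : Prop :=
  ∀ (x : ℝ) (y : EuclideanSpace ℝ (Fin n)),
    cubicEval h (x, y) = x ^ 3 - x * inner ℝ y y + cubicEval P y

/-- The affine subspace `{x³ - x⟨y, y⟩ + P(y) | P ∈ Sym³(ℝⁿ)^*}` of `Sym³(ℝⁿ⁺¹)^*`. -/
def standardSpace (n : ℕ) : AffineSubspace ℝ (CubicForm (Ambient n)) where
  carrier := {h | ∃ P, IsStandardForm h P}
  smul_vsub_vadd_mem' := by
    rintro c h₁ h₂ h₃ ⟨P₁, H₁⟩ ⟨P₂, H₂⟩ ⟨P₃, H₃⟩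
    refine ⟨c • (P₁ - P₂) + P₃, fun x y => ?_⟩
    have e₁ := H₁ x y
    have e₂ := H₂ x y
    have e₃ := H₃ x y
    simp only [cubicEval] at e₁ e₂ e₃ ⊢
    simp [e₁, e₂, e₃]
    ring

/-- The set `𝒞ₙ` of all `x³ - x⟨y, y⟩ + P(y)` with `max_{‖y‖ = 1} P(y) ≤ 2 / (3√3)`. -/
def generatingSet (n : ℕ) : Set (CubicForm (Ambient n)) :=
  {h | ∃ P, IsStandardForm h P ∧
    ∀ y : EuclideanSpace ℝ (Fin n), ‖y‖ = 1 → cubicEval P y ≤ 2 / (3 * √3)}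

/-- The part of `𝒞ₙ` in the affine subspace `standardSpace n`, as a subset of that space. -/
def generatingSetIn (n : ℕ) : Set (standardSpace n) :=
  {h | (h : CubicForm (Ambient n)) ∈ generatingSet n}

/-- The boundary `∂𝒞ₙ`, taken in the affine subspace `standardSpace n`. -/
def generatingBoundary (n : ℕ) : Set (CubicForm (Ambient n)) :=
  Subtype.val '' frontier (generatingSetIn n)

/-- The connected component of `{h = 1}` that contains the point `(x, y) = (1, 0)`. -/
def standardComponent {n : ℕ} (h : CubicForm (Ambient n)) : Set (Ambient n) :=
  connectedComponentIn {p | cubicEval h p = 1} (1, 0)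

/-- `S` is a (locally flat) topological submanifold of dimension `d` of the manifold `X` modelled
on the vector space `V`: around each of its points there is a chart of `X` with values in `V`
that carries `S` to a `d`-dimensional linear subspace. -/
def IsTopSubmanifold {X : Type*} [TopologicalSpace X] (V : Type*) [AddCommGroup V]
    [Module ℝ V] [TopologicalSpace V] (S : Set X) (d : ℕ) : Prop :=
  ∀ p ∈ S, ∃ (e : OpenPartialHomeomorph X V) (W : Submodule ℝ V),
    p ∈ e.source ∧ finrank ℝ W = d ∧ ∀ q ∈ e.source, q ∈ S ↔ e q ∈ W

end

/-! At a point p of H, the form -3h(p,·,·) is positive definite on ker dh_p. An orthonormal basis of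
this kernel, together with p, brings h into the form x³ - x⟨y,y⟩ + P(y) (`exists_normalForm`). Over
a unit vector u with c = P(u), the slice x = 1 then reads 1 - t² + ct³ along y = tu; c = 2/(3√3) is
the value at which this acquires a double root, at t = √3.

If P ≤ 2/(3√3) on the unit sphere, then h ≤ 0 on the wall ‖y‖ = √3x. The component of {h = 1}
through (1,0) is therefore trapped in the cone ‖y‖ < √3x, and radial contraction towards the axis
shows that it is all of {h = 1} there (`standardComponent_eq`). Every horizontal line through a
point of the cone with h > 0 meets {h = 0} on both sides, so h is real-rooted on it, and Newton's
inequality (`newton_of_roots`) is hyperbolicity. If instead c > 2/(3√3), then h stays positive on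
the whole ray, the ray projects into the component, and the 2 × 2 Hessian determinant -1/3 + ct -
t²/9 is positive at t = 9c/2, so hyperbolicity fails there (`le_of_isHyperbolicPoint`).

At a nonzero boundary point q = (x,y) of the cone, h(q) = 0 gives dh_q(0,y) = x(‖y‖² - 3x²), so dh
can vanish only on the wall. A strict bound on P keeps the boundary off the wall and makes it
regular (`regular_at_frontier`). Equality at u makes (1,√3u) a singular boundary point, because dP
is radial at a maximum (`exists_singular_frontier_point`).

Finally 𝒞ₙ is cut out by closed affine inequalities, and it is bounded because cubics are odd, so
that an upper bound is two-sided. Its boundary is a level set of a gauge, which radial rescaling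
flattens. -/

/-! ### Symmetric trilinear forms -/

namespace CubicForm

variable {E F : Type*} [NormedAddCommGroup E] [NormedSpace ℝ E]
  [NormedAddCommGroup F] [NormedSpace ℝ F]

/-- The polarization of a homogeneous cubic polynomial. -/
def tri (h : CubicForm E) (a b c : E) : ℝ :=
  (h : ContinuousMultilinearMap ℝ (fun _ : Fin 3 => E) ℝ) ![a, b, c]

theorem cubicEval_eq (h : CubicForm E) (v : E) : cubicEval h v = h.tri v v v := by
  unfold cubicEval tri
  congr 1
  ext i
  fin_cases i <;> rfl

theorem apply_eq_tri (h : CubicForm E) (v : Fin 3 → E) :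
    (h : ContinuousMultilinearMap ℝ (fun _ : Fin 3 => E) ℝ) v = h.tri (v 0) (v 1) (v 2) := by
  unfold tri
  congr 1
  ext i
  fin_cases i <;> rfl

theorem tri_swap_left (h : CubicForm E) (a b c : E) : h.tri a b c = h.tri b a c := by
  have := h.2 (Equiv.swap 0 1) ![b, a, c]
  rw [apply_eq_tri, apply_eq_tri] at this
  simpa [Equiv.swap_apply_def] using this

theorem tri_swap_right (h : CubicForm E) (a b c : E) : h.tri a b c = h.tri a c b := by
  have := h.2 (Equiv.swap 1 2) ![a, c, b]
  rw [apply_eq_tri, apply_eq_tri] at this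
  simpa [Equiv.swap_apply_def] using this

@[simp]
theorem tri_add_left (h : CubicForm E) (a a' b c : E) :
    h.tri (a + a') b c = h.tri a b c + h.tri a' b c := by
  have := h.1.map_update_add ![0, b, c] 0 a a'
  rwa [apply_eq_tri, apply_eq_tri, apply_eq_tri] at this

@[simp]
theorem tri_smul_left (h : CubicForm E) (t : ℝ) (a b c : E) :
    h.tri (t • a) b c = t * h.tri a b c := by
  have := h.1.map_update_smul ![0, b, c] 0 t a
  rwa [apply_eq_tri, apply_eq_tri, smul_eq_mul] at this

@[simp]
theorem tri_add_mid (h : CubicForm E) (a b b' c : E) :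
    h.tri a (b + b') c = h.tri a b c + h.tri a b' c := by
  rw [tri_swap_left, tri_add_left, tri_swap_left, tri_swap_left h b']

@[simp]
theorem tri_smul_mid (h : CubicForm E) (t : ℝ) (a b c : E) :
    h.tri a (t • b) c = t * h.tri a b c := by
  rw [tri_swap_left, tri_smul_left, tri_swap_left]

@[simp]
theorem tri_add_right (h : CubicForm E) (a b c c' : E) :
    h.tri a b (c + c') = h.tri a b c + h.tri a b c' := by
  rw [tri_swap_right, tri_add_mid, tri_swap_right, tri_swap_right h _ c']

@[simp]
theorem tri_smul_right (h : CubicForm E) (t : ℝ) (a b c : E) :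
    h.tri a b (t • c) = t * h.tri a b c := by
  rw [tri_swap_right, tri_smul_mid, tri_swap_right]

@[simp] theorem tri_zero_left (h : CubicForm E) (b c : E) : h.tri 0 b c = 0 := by
  simpa using h.tri_smul_left 0 0 b c

@[simp] theorem tri_zero_right (h : CubicForm E) (a b : E) : h.tri a b 0 = 0 := by
  simpa using h.tri_smul_right 0 a b 0

theorem ext_tri {h k : CubicForm E} (H : ∀ a b c, h.tri a b c = k.tri a b c) : h = k := by
  apply Subtype.ext
  ext v
  rw [apply_eq_tri, apply_eq_tri, H]

/-- Polarization identity. -/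
theorem tri_polarization (h : CubicForm E) (a b c : E) :
    6 * h.tri a b c = cubicEval h (a + b + c) - cubicEval h (a + b) - cubicEval h (a + c)
      - cubicEval h (b + c) + cubicEval h a + cubicEval h b + cubicEval h c := by
  simp only [cubicEval_eq, tri_add_left, tri_add_mid, tri_add_right]
  rw [h.tri_swap_right a c b, h.tri_swap_left b a c, h.tri_swap_right b c a, h.tri_swap_left b a c,
    h.tri_swap_left c a b, h.tri_swap_right a c b, h.tri_swap_right c b a, h.tri_swap_left c a b,
    h.tri_swap_right a c b]
  ring

theorem cubicEval_add_smul (h : CubicForm E) (p v : E) (t : ℝ) :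
    cubicEval h (p + t • v)
      = h.tri p p p + 3 * h.tri p p v * t + 3 * h.tri p v v * t ^ 2 + h.tri v v v * t ^ 3 := by
  simp only [cubicEval_eq, tri_add_left, tri_add_mid, tri_add_right, tri_smul_left, tri_smul_mid,
    tri_smul_right]
  rw [h.tri_swap_right p v p, h.tri_swap_left v p p, h.tri_swap_right p v p,
    h.tri_swap_left v p v, h.tri_swap_right v v p, h.tri_swap_left v p v]
  ring

theorem cubicEval_smul (h : CubicForm E) (t : ℝ) (v : E) :
    cubicEval h (t • v) = t ^ 3 * cubicEval h v := by
  simp only [cubicEval_eq, tri_smul_left, tri_smul_mid, tri_smul_right]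
  ring

theorem cubicEval_neg (h : CubicForm E) (v : E) : cubicEval h (-v) = - cubicEval h v := by
  rw [← neg_one_smul ℝ v, cubicEval_smul]
  ring

/-- A cubic form is determined by the polynomial, compatibly with linear substitutions. -/
theorem tri_map_of_cubicEval_map {h : CubicForm E} {k : CubicForm F} (A : F →ₗ[ℝ] E)
    (H : ∀ p, cubicEval h (A p) = cubicEval k p) (a b c : F) :
    h.tri (A a) (A b) (A c) = k.tri a b c := by
  have h1 := h.tri_polarization (A a) (A b) (A c)
  have h2 := k.tri_polarization a b c
  simp only [← map_add, H] at h1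
  linarith

theorem ext_cubicEval {h k : CubicForm E} (H : ∀ p, cubicEval h p = cubicEval k p) : h = k :=
  ext_tri fun a b c => by
    have h1 := h.tri_polarization a b c
    have h2 := k.tri_polarization a b c
    simp only [H] at h1
    linarith

/-- A symmetric continuous function that is linear in its first argument is a cubic form. -/
def ofTri (T : E → E → E → ℝ) (hadd : ∀ a a' b c, T (a + a') b c = T a b c + T a' b c)
    (hsmul : ∀ (t : ℝ) a b c, T (t • a) b c = t * T a b c) (hl : ∀ a b c, T a b c = T b a c)
    (hr : ∀ a b c, T a b c = T a c b)
    (hc : Continuous fun v : Fin 3 → E => T (v 0) (v 1) (v 2)) : CubicForm E :=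
  ⟨{ toFun := fun v => T (v 0) (v 1) (v 2)
     map_update_add' := by
       intro inst v i a b
       obtain rfl : inst = instDecidableEqFin 3 := Subsingleton.elim _ _
       fin_cases i
       · simp [hadd]
       · simp [hl (v 0), hadd]
       · simp [hr (v 0), hl (v 0), hadd]
     map_update_smul' := by
       intro inst v i t b
       obtain rfl : inst = instDecidableEqFin 3 := Subsingleton.elim _ _
       fin_cases i
       · simp [hsmul]
       · simp [hl (v 0), hsmul]
       · simp [hr (v 0), hl (v 0), hsmul]
     cont := hc }, by
    -- The two adjacent transpositions generate the permutations of three letters.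
    have key : ∀ σ : Equiv.Perm (Fin 3), ∀ v : Fin 3 → E,
        T (v (σ 0)) (v (σ 1)) (v (σ 2)) = T (v 0) (v 1) (v 2) := by
      intro σ v
      have h01 : σ 0 ≠ σ 1 := σ.injective.ne (by decide)
      have h02 : σ 0 ≠ σ 2 := σ.injective.ne (by decide)
      have h12 : σ 1 ≠ σ 2 := σ.injective.ne (by decide)
      clear hadd hsmul hc
      generalize σ 0 = i at *
      generalize σ 1 = j at *
      generalize σ 2 = k at *
      fin_cases i <;> fin_cases j <;> fin_cases k <;>
        simp only [Fin.zero_eta, Fin.mk_one, Fin.reduceFinMk, ne_eq, not_true_eq_false] at *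
      · exact hr _ _ _
      · exact hl _ _ _
      · rw [hr, hl]
      · rw [hl, hr]
      · rw [hl, hr, hl]
    exact fun σ v => key σ v⟩

@[simp]
theorem tri_ofTri (T : E → E → E → ℝ) (hadd hsmul hl hr hc) (a b c : E) :
    (ofTri T hadd hsmul hl hr hc).tri a b c = T a b c := rfl

@[simp] theorem tri_add (h k : CubicForm E) (a b c : E) :
    (h + k).tri a b c = h.tri a b c + k.tri a b c := rfl

@[simp] theorem tri_smul (t : ℝ) (h : CubicForm E) (a b c : E) :
    (t • h).tri a b c = t * h.tri a b c := rfl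

@[simp] theorem tri_zero (a b c : E) : (0 : CubicForm E).tri a b c = 0 := rfl

theorem continuous_tri (h : CubicForm E) :
    Continuous fun v : Fin 3 → E => h.tri (v 0) (v 1) (v 2) := by
  have := h.1.cont
  refine this.congr fun v => h.apply_eq_tri v

theorem continuous_cubicEval (h : CubicForm E) : Continuous (cubicEval h) :=
  h.1.cont.comp (continuous_pi fun _ => continuous_id)

/-- Linear substitution `h ↦ h ∘ A`. -/
def pullback (A : F →L[ℝ] E) : CubicForm E →ₗ[ℝ] CubicForm F where
  toFun h := ofTri (fun a b c => h.tri (A a) (A b) (A c)) (by simp) (by simp)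
    (fun a b c => h.tri_swap_left _ _ _) (fun a b c => h.tri_swap_right _ _ _)
    (h.continuous_tri.comp (f := fun v : Fin 3 → F => fun i => A (v i))
      (continuous_pi fun i => A.continuous.comp (continuous_apply i)))
  map_add' h k := ext_tri fun a b c => by simp
  map_smul' t h := ext_tri fun a b c => by simp

@[simp]
theorem tri_pullback (A : F →L[ℝ] E) (h : CubicForm E) (a b c : F) :
    (pullback A h).tri a b c = h.tri (A a) (A b) (A c) := rfl

theorem cubicEval_pullback (A : F →L[ℝ] E) (h : CubicForm E) (a : F) :
    cubicEval (pullback A h) a = cubicEval h (A a) := by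
  simp [cubicEval_eq]

theorem cubicEval_add (h k : CubicForm E) (a : E) :
    cubicEval (h + k) a = cubicEval h a + cubicEval k a := rfl

theorem cubicEval_sub (h k : CubicForm E) (a : E) :
    cubicEval (h - k) a = cubicEval h a - cubicEval k a := rfl

theorem cubicEval_const_smul (t : ℝ) (h : CubicForm E) (a : E) :
    cubicEval (t • h) a = t * cubicEval h a := rfl

instance [FiniteDimensional ℝ E] : FiniteDimensional ℝ (CubicForm E) :=
  FiniteDimensional.of_injective
    ({ toFun := fun h => h.1.toMultilinearMap
       map_add' := fun _ _ => rfl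
       map_smul' := fun _ _ => rfl } : CubicForm E →ₗ[ℝ] MultilinearMap ℝ (fun _ : Fin 3 => E) ℝ)
    (ContinuousMultilinearMap.toMultilinearMap_injective.comp Subtype.val_injective)

/-! ### Derivatives of cubic polynomials -/

theorem hasFDerivAt_cubicEval (h : CubicForm E) (p : E) :
    ∃ L : E →L[ℝ] ℝ, HasFDerivAt (cubicEval h) L p ∧ ∀ v, L v = 3 * h.tri p p v := by
  have h1 := h.1.hasFDerivAt (fun _ => p)
  have h2 : HasFDerivAt (fun q : E => (fun _ : Fin 3 => q))
      (ContinuousLinearMap.pi fun _ => ContinuousLinearMap.id ℝ E) p :=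
    (ContinuousLinearMap.pi fun _ : Fin 3 => ContinuousLinearMap.id ℝ E).hasFDerivAt
  refine ⟨_, h1.comp p h2, fun v => ?_⟩
  simp [ContinuousMultilinearMap.linearDeriv_apply, Fin.sum_univ_three, apply_eq_tri]
  rw [h.tri_swap_left v p p, h.tri_swap_right p v p]
  ring

theorem fderiv_cubicEval (h : CubicForm E) (p v : E) :
    fderiv ℝ (cubicEval h) p v = 3 * h.tri p p v := by
  obtain ⟨L, h1, h2⟩ := h.hasFDerivAt_cubicEval p
  rw [h1.fderiv, h2]

theorem contDiff_cubicEval (h : CubicForm E) : ContDiff ℝ 2 (cubicEval h) :=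
  h.1.contDiff.comp (contDiff_pi.2 fun _ => contDiff_id)

/-- Along the line p + tv the first derivative in direction w is an explicit quadratic in t; its
linear coefficient is the value sought. -/
theorem fderiv_fderiv_cubicEval (h : CubicForm E) (p v w : E) :
    fderiv ℝ (fderiv ℝ (cubicEval h)) p v w = 6 * h.tri p v w := by
  have hd : DifferentiableAt ℝ (fderiv ℝ (cubicEval h)) p :=
    (h.contDiff_cubicEval.fderiv_right (m := 1) (by norm_num)).differentiable (by norm_num) p
  have h1 : HasDerivAt (fun t : ℝ => fderiv ℝ (cubicEval h) (p + t • v) w)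
      (fderiv ℝ (fderiv ℝ (cubicEval h)) p v w) 0 := by
    have := (hd.hasFDerivAt.clm_apply (hasFDerivAt_const w p)).hasLineDerivAt v
    simpa [HasLineDerivAt] using this
  have h2 : HasDerivAt (fun t : ℝ => fderiv ℝ (cubicEval h) (p + t • v) w)
      (6 * h.tri p v w) 0 := by
    have : (fun t : ℝ => fderiv ℝ (cubicEval h) (p + t • v) w)
        = fun t => 3 * h.tri p p w + (6 * h.tri p v w) * t + 3 * h.tri v v w * t ^ 2 := by
      funext t
      simp only [fderiv_cubicEval, tri_add_left, tri_add_mid, tri_smul_left, tri_smul_mid]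
      rw [h.tri_swap_left v p w]
      ring
    rw [this]
    have := (((hasDerivAt_id (0 : ℝ)).const_mul (6 * h.tri p v w)).const_add
      (3 * h.tri p p w)).add (((hasDerivAt_id (0 : ℝ)).pow 2).const_mul (3 * h.tri v v w))
    exact this.congr_deriv (by simp)
  exact h1.unique h2

theorem negHessian_apply (h : CubicForm E) (p v w : E) :
    negHessian (cubicEval h) p v w = - (6 * h.tri p v w) := by
  rw [← fderiv_fderiv_cubicEval]
  rfl

end CubicForm

/-! ### Hyperbolic points and normal forms -/

namespace CubicForm

variable {E : Type*} [NormedAddCommGroup E] [NormedSpace ℝ E] {n : ℕ}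

/-- The linear form `v ↦ h(p, q, v)`. -/
def triLin (h : CubicForm E) (p q : E) : E →ₗ[ℝ] ℝ where
  toFun v := h.tri p q v
  map_add' := by simp
  map_smul' := by simp

@[simp] theorem triLin_apply (h : CubicForm E) (p q v : E) : h.triLin p q v = h.tri p q v := rfl

theorem finrank_ambient (n : ℕ) : finrank ℝ (Ambient n) = n + 1 := by
  simp [add_comm]

theorem finrank_ker_triLin (h : CubicForm (Ambient n)) {p q : Ambient n} {v : Ambient n}
    (hv : h.tri p q v ≠ 0) : finrank ℝ (LinearMap.ker (h.triLin p q)) = n := by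
  have h0 : h.triLin p q ≠ 0 := fun h0 => hv (by rw [← triLin_apply, h0, LinearMap.zero_apply])
  have := Module.Dual.finrank_ker_add_one_of_ne_zero h0
  rw [finrank_ambient] at this
  omega

/-- The line through p is negative for -∂²h_p, and its orthogonal complement is the kernel of
h(p,p,·), of dimension n. So signature (n,1) amounts to definiteness on that kernel, which replaces
signatures from here on. -/
theorem isHyperbolicPoint_iff (h : CubicForm (Ambient n)) (p : Ambient n) :
    IsHyperbolicPoint (cubicEval h) p ↔
      0 < cubicEval h p ∧ ∀ v ≠ 0, h.tri p p v = 0 → h.tri p v v < 0 := by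
  have hQ : ∀ v, (negHessian (cubicEval h) p).toQuadraticMap v = - (6 * h.tri p v v) := fun v => by
    rw [LinearMap.BilinMap.toQuadraticMap_apply, negHessian_apply]
  have hN : ∀ v, (-(negHessian (cubicEval h) p).toQuadraticMap) v = 6 * h.tri p v v := fun v => by
    rw [neg_apply, hQ, neg_neg]
  refine and_congr_right fun hp => ⟨fun ⟨hpos, _⟩ v hv0 hv => ?_, fun H => ?_⟩
  · rw [cubicEval_eq] at hp
    by_contra! hvv
    -- A bad v would span with p a plane on which the form is nonpositive, leaving at most n - 1
    -- positive directions.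
    have hli : LinearIndependent ℝ ![p, v] := by
      rw [LinearIndependent.pair_iff]
      intro s t hst
      have h1 : h.tri p p (s • p + t • v) = 0 := by rw [hst, tri_zero_right]
      simp only [tri_add_right, tri_smul_right, hv, mul_zero, add_zero] at h1
      have hs : s = 0 := by simpa [hp.ne'] using h1
      subst hs
      simpa [hv0] using hst
    have hnp : ∀ x ∈ Submodule.span ℝ (Set.range ![p, v]),
        (negHessian (cubicEval h) p).toQuadraticMap x ≤ 0 := by
      intro x hx
      rw [Matrix.range_cons, Matrix.range_cons, Matrix.range_empty, union_empty,
        singleton_union, Submodule.mem_span_pair] at hx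
      obtain ⟨s, t, rfl⟩ := hx
      rw [hQ]
      simp only [tri_add_right, tri_smul_right, tri_add_mid, tri_smul_mid, hv,
        h.tri_swap_right p v p]
      nlinarith [mul_nonneg (sq_nonneg s) hp.le, mul_nonneg (sq_nonneg t) hvv]
    have := QuadraticForm.sigPos_add_finrank_le_of_nonpos hnp
    rw [hpos, finrank_span_eq_card hli, finrank_ambient, Fintype.card_fin] at this
    omega
  · rw [cubicEval_eq] at hp
    have h1 : n ≤ sigPos (negHessian (cubicEval h) p).toQuadraticMap := by
      refine (h.finrank_ker_triLin hp.ne').ge.trans (le_sigPos_of_posDef _ fun v hv => ?_)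
      rw [QuadraticMap.restrict_apply, hQ]
      have := H v (by simpa using hv) v.2
      linarith
    have h2 : 1 ≤ sigNeg (negHessian (cubicEval h) p).toQuadraticMap := by
      have hp0 : p ≠ 0 := by
        rintro rfl
        simp at hp
      rw [← finrank_span_singleton (K := ℝ) hp0]
      refine le_sigNeg_of_negDef _ fun v hv => ?_
      rw [QuadraticMap.restrict_apply, hN]
      obtain ⟨v, hv'⟩ := v
      obtain ⟨t, rfl⟩ := Submodule.mem_span_singleton.1 hv'
      have ht : t ≠ 0 := by
        rintro rfl
        simp at hv
      have := mul_pos (mul_self_pos.2 ht) hp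
      simp only [tri_smul_mid, tri_smul_right]
      linarith
    have h3 := QuadraticForm.sigPos_add_sigNeg_add_radical
      (Q := (negHessian (cubicEval h) p).toQuadraticMap)
    rw [finrank_ambient] at h3
    omega

/-- At a hyperbolic point on the level set `{h = 1}`, linear coordinates bring `h` into the form
`x³ - x⟨y, y⟩ + P(y)`. -/
theorem exists_normalForm (h : CubicForm (Ambient n)) {p : Ambient n}
    (hp : IsHyperbolicPoint (cubicEval h) p) (hp1 : cubicEval h p = 1) :
    ∃ (A : Ambient n ≃ₗ[ℝ] Ambient n) (P : CubicForm (EuclideanSpace ℝ (Fin n))), A (1, 0) = p ∧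
      ∀ x y, cubicEval h (A (x, y)) = x ^ 3 - x * inner ℝ y y + cubicEval P y := by
  obtain ⟨-, H⟩ := (h.isHyperbolicPoint_iff p).1 hp
  rw [cubicEval_eq] at hp1
  let K := LinearMap.ker (h.triLin p p)
  have hKn : finrank ℝ K = n := h.finrank_ker_triLin (v := p) (by rw [hp1]; norm_num)
  -- The factor 3 is the binomial coefficient in h(xp + v) = x³ + 3x h(p,v,v) + h(v,v,v), so that B
  -- becomes ⟨y,y⟩.
  let B : LinearMap.BilinForm ℝ K := LinearMap.mk₂ ℝ (fun v w => -(3 * h.tri p v w))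
    (by intros; simp; ring) (by intros; simp; ring) (by intros; simp; ring)
    (by intros; simp; ring)
  have hB : ∀ v w : K, B v w = -(3 * h.tri p v w) := fun _ _ => rfl
  have hBpos : ∀ v : K, v ≠ 0 → 0 < B v v := fun v hv => by
    have := H v (by simpa using hv) v.2
    rw [hB]
    linarith
  obtain ⟨v₀, hv₀⟩ := LinearMap.BilinForm.exists_orthogonal_basis (B := B)
    ⟨fun v w => by simp only [hB, RingHom.id_apply, h.tri_swap_right p v w]⟩
  have hpos : ∀ i, 0 < B (v₀ i) (v₀ i) := fun i => hBpos _ (v₀.ne_zero i)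
  let w : Basis (Fin n) ℝ K := (v₀.isUnitSMul (w := fun i => (√(B (v₀ i) (v₀ i)))⁻¹)
    fun i => (inv_ne_zero (Real.sqrt_pos.2 (hpos i)).ne').isUnit).reindex (finCongr hKn)
  have hw : ∀ i j, B (w i) (w j) = if i = j then 1 else 0 := by
    intro i j
    simp only [w, Basis.reindex_apply, Basis.isUnitSMul_apply, map_smul, LinearMap.smul_apply,
      smul_eq_mul]
    split_ifs with hij
    · subst hij
      rw [← mul_assoc, ← mul_inv, Real.mul_self_sqrt (hpos _).le, inv_mul_cancel₀ (hpos _).ne']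
    · have : B (v₀ ((finCongr hKn).symm i)) (v₀ ((finCongr hKn).symm j)) = 0 :=
        hv₀ ((finCongr hKn).symm.injective.ne hij)
      rw [this]
      simp
  let L : EuclideanSpace ℝ (Fin n) ≃ₗ[ℝ] K :=
    (EuclideanSpace.basisFun (Fin n) ℝ).toBasis.equiv w (Equiv.refl _)
  have hL : ∀ y, L y = ∑ i, y i • w i := fun y => by
    conv_lhs => rw [← (EuclideanSpace.basisFun (Fin n) ℝ).toBasis.sum_repr y]
    simp only [map_sum, map_smul, L, Basis.equiv_apply, Equiv.refl_apply]
    simp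
  have hLL : ∀ y, B (L y) (L y) = inner ℝ y y := fun y => by
    rw [hL]
    simp only [map_sum, map_smul, LinearMap.sum_apply, LinearMap.smul_apply, hw, smul_eq_mul,
      PiLp.inner_apply]
    simp [sq]
  let A₀ : Ambient n →ₗ[ℝ] Ambient n :=
    (LinearMap.toSpanSingleton ℝ (Ambient n) p).coprod (K.subtype ∘ₗ L.toLinearMap)
  have hA₀ : ∀ x y, A₀ (x, y) = x • p + (L y : Ambient n) := fun x y => by simp [A₀]
  have hK : ∀ y, h.tri p p (L y) = 0 := fun y => (L y).2
  have hinj : Function.Injective A₀ := by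
    rw [injective_iff_map_eq_zero]
    rintro ⟨x, y⟩ hxy
    rw [hA₀] at hxy
    have h1 : h.tri p p (x • p + (L y : Ambient n)) = 0 := by rw [hxy, tri_zero_right]
    simp only [tri_add_right, tri_smul_right, hK, hp1, add_zero, mul_one] at h1
    subst h1
    simpa using hxy
  refine ⟨LinearEquiv.ofInjectiveEndo A₀ hinj,
    pullback (K.subtype ∘ₗ L.toLinearMap).toContinuousLinearMap h, ?_, fun x y => ?_⟩
  · rw [LinearEquiv.coe_ofInjectiveEndo, hA₀]
    simp
  · rw [LinearEquiv.coe_ofInjectiveEndo, hA₀, add_comm, cubicEval_add_smul, cubicEval_pullback,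
      ← hLL, hB]
    rw [h.tri_swap_right (L y : Ambient n) _ p, h.tri_swap_left (L y : Ambient n) p,
      h.tri_swap_left (L y : Ambient n) p p, h.tri_swap_right p _ p, hK, hp1, cubicEval_eq]
    simp
    ring

/-! ### Boundary points -/

/-- A sufficient condition for regular boundary behaviour: `dh_p ≠ 0`, and `-∂²h_p` is positive
semi-definite on `ker dh_p` with isotropic vectors on the line through `p` only. -/
theorem hasRegularBoundary_of (h : CubicForm (Ambient n)) (H : Set (Ambient n))
    (hreg : ∀ p ∈ frontier (posCone H), p ≠ 0 → h.tri p p p = 0 ∧ (∃ v, h.tri p p v ≠ 0) ∧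
      ∀ v, h.tri p p v = 0 → h.tri p v v < 0 ∨ ∃ t : ℝ, v = t • p) :
    HasRegularBoundary h H := by
  intro p hp hp0
  obtain ⟨hp3, ⟨v₀, hv₀⟩, hneg⟩ := hreg p hp hp0
  have hker : ∀ v, v ∈ (fderiv ℝ (cubicEval h) p).ker ↔ h.tri p p v = 0 := fun v => by
    rw [LinearMap.mem_ker]
    simp [fderiv_cubicEval]
  refine ⟨fun h0 => hv₀ ?_, fun v hv => ?_, ?_⟩
  · have := h.fderiv_cubicEval p v₀
    rw [h0] at this
    simpa using this.symm
  · rw [negHessian_apply]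
    rcases hneg v ((hker v).1 hv) with hv | ⟨t, rfl⟩
    · linarith
    · simp [hp3]
  · have hpk : p ∈ (fderiv ℝ (cubicEval h) p).ker := (hker p).2 hp3
    -- A vector of the kernel is isotropic, hence a multiple of p; conversely p pairs to zero with
    -- every w satisfying h(p,p,w) = 0.
    have : LinearMap.ker ((negHessian (cubicEval h) p).restrict (fderiv ℝ (cubicEval h) p).ker)
        = Submodule.span ℝ {⟨p, hpk⟩} := by
      ext ⟨v, hv⟩
      rw [LinearMap.mem_ker, Submodule.mem_span_singleton]
      constructor
      · intro hv0
        have h1 : negHessian (cubicEval h) p v v = 0 := by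
          simpa using LinearMap.congr_fun hv0 ⟨v, hv⟩
        rw [negHessian_apply] at h1
        rcases hneg v ((hker v).1 hv) with hv | ⟨t, rfl⟩
        · linarith
        · exact ⟨t, rfl⟩
      · rintro ⟨t, ht⟩
        obtain rfl : t • p = v := congrArg Subtype.val ht
        ext ⟨w, hw⟩
        have : negHessian (cubicEval h) p (t • p) w = 0 := by
          rw [negHessian_apply]
          simp [(hker w).1 hw]
        simpa using this
    rw [this, finrank_span_singleton]
    simpa using hp0

theorem not_hasRegularBoundary_of (h : CubicForm (Ambient n)) (H : Set (Ambient n)) {p : Ambient n}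
    (hp : p ∈ frontier (posCone H)) (hp0 : p ≠ 0) (hpp : ∀ v, h.tri p p v = 0) :
    ¬ HasRegularBoundary h H := fun hreg => (hreg p hp hp0).1 <| by
  ext v <;> simp [fderiv_cubicEval, hpp]

end CubicForm

/-! ### Cubics in standard form -/

namespace CubicForm

variable {n : ℕ}

/-- The cubic `x³ - x⟨y, y⟩`. -/
noncomputable def standardCubic (n : ℕ) : CubicForm (Ambient n) :=
  ofTri (fun a b c => a.1 * b.1 * c.1
      - (a.1 * inner ℝ b.2 c.2 + b.1 * inner ℝ a.2 c.2 + c.1 * inner ℝ a.2 b.2) / 3)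
    (by intros; simp [inner_add_left]; ring) (by intros; simp [real_inner_smul_left]; ring)
    (by intro a b c; rw [real_inner_comm a.2 b.2]; ring)
    (by intro a b c; rw [real_inner_comm b.2 c.2]; ring)
    (by fun_prop)

theorem tri_standardCubic (a b c : Ambient n) : (standardCubic n).tri a b c = a.1 * b.1 * c.1
    - (a.1 * inner ℝ b.2 c.2 + b.1 * inner ℝ a.2 c.2 + c.1 * inner ℝ a.2 b.2) / 3 := rfl

theorem isStandardForm_iff {h : CubicForm (Ambient n)} {P : CubicForm (EuclideanSpace ℝ (Fin n))} :
    IsStandardForm h P ↔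
      h = standardCubic n + pullback (ContinuousLinearMap.snd ℝ ℝ (EuclideanSpace ℝ (Fin n))) P := by
  have key : ∀ x y, cubicEval (standardCubic n
      + pullback (ContinuousLinearMap.snd ℝ ℝ (EuclideanSpace ℝ (Fin n))) P) (x, y)
      = x ^ 3 - x * inner ℝ y y + cubicEval P y := by
    intro x y
    rw [cubicEval_add, cubicEval_pullback, cubicEval_eq, tri_standardCubic,
      ContinuousLinearMap.coe_snd']
    ring
  constructor
  · intro H
    refine ext_cubicEval ?_
    rintro ⟨x, y⟩
    rw [H, key]
  · rintro rfl
    exact key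

/-- On the wall ‖y‖ = √3x the extremal P contributes 2x³, exactly cancelling x³ - 3x³. -/
theorem crit_mul_cube (x : ℝ) : 2 / (3 * √3) * (√3 * x) ^ 3 = 2 * x ^ 3 := by
  have h3 : √3 ^ 2 = 3 := Real.sq_sqrt (by norm_num)
  have h0 : √3 ≠ 0 := by positivity
  field_simp
  rw [h3]

theorem crit_sq : (2 / (3 * √3)) ^ 2 = 4 / 27 := by
  rw [div_pow, mul_pow, Real.sq_sqrt (by norm_num)]
  norm_num

section StandardForm

variable {h : CubicForm (Ambient n)} {P : CubicForm (EuclideanSpace ℝ (Fin n))}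

theorem _root_.IsStandardForm.tri_eq (hs : IsStandardForm h P) (a b c : Ambient n) :
    h.tri a b c = a.1 * b.1 * c.1
      - (a.1 * inner ℝ b.2 c.2 + b.1 * inner ℝ a.2 c.2 + c.1 * inner ℝ a.2 b.2) / 3
      + P.tri a.2 b.2 c.2 := by
  rw [isStandardForm_iff.1 hs]
  rfl

theorem _root_.IsStandardForm.eval_eq (hs : IsStandardForm h P) (q : Ambient n) :
    cubicEval h q = q.1 ^ 3 - q.1 * ‖q.2‖ ^ 2 + cubicEval P q.2 := by
  rw [← real_inner_self_eq_norm_sq]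
  exact hs q.1 q.2

theorem cubicEval_le_of_unit {E : Type*} [NormedAddCommGroup E] [NormedSpace ℝ E]
    {P : CubicForm E} {C : ℝ} (hP : ∀ y : E, ‖y‖ = 1 → cubicEval P y ≤ C) (y : E) :
    cubicEval P y ≤ C * ‖y‖ ^ 3 := by
  rcases eq_or_ne y 0 with rfl | hy
  · simp [cubicEval_eq]
  · have hy' : 0 < ‖y‖ := norm_pos_iff.2 hy
    have := hP (‖y‖⁻¹ • y) (by rw [norm_smul, norm_inv, norm_norm, inv_mul_cancel₀ hy'.ne'])
    rw [cubicEval_smul, inv_pow, inv_mul_le_iff₀ (by positivity)] at this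
    linarith

theorem cubicEval_lt_of_unit {E : Type*} [NormedAddCommGroup E] [NormedSpace ℝ E]
    {P : CubicForm E} {C : ℝ} (hP : ∀ y : E, ‖y‖ = 1 → cubicEval P y < C) {y : E} (hy : y ≠ 0) :
    cubicEval P y < C * ‖y‖ ^ 3 := by
  have hy' : 0 < ‖y‖ := norm_pos_iff.2 hy
  have := hP (‖y‖⁻¹ • y) (by rw [norm_smul, norm_inv, norm_norm, inv_mul_cancel₀ hy'.ne'])
  rw [cubicEval_smul, inv_pow, inv_mul_lt_iff₀ (by positivity)] at this
  linarith

/-! ### Signs of h on the cone ‖y‖ ≤ √3x and on its wall -/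

theorem eval_nonpos_of_norm_eq (hs : IsStandardForm h P)
    (hP : ∀ y, ‖y‖ = 1 → cubicEval P y ≤ 2 / (3 * √3)) {q : Ambient n}
    (hq : ‖q.2‖ = √3 * q.1) : cubicEval h q ≤ 0 := by
  have h1 := cubicEval_le_of_unit hP q.2
  have h3 : √3 ^ 2 = 3 := Real.sq_sqrt (by norm_num)
  rw [hq, crit_mul_cube] at h1
  rw [hs.eval_eq, hq, mul_pow, h3]
  linarith

theorem eval_neg_of_norm_eq (hs : IsStandardForm h P)
    (hP : ∀ y, ‖y‖ = 1 → cubicEval P y < 2 / (3 * √3)) {q : Ambient n}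
    (hq : ‖q.2‖ = √3 * q.1) (hq0 : 0 < q.1) : cubicEval h q < 0 := by
  have h0 : q.2 ≠ 0 := by
    rw [← norm_pos_iff, hq]
    positivity
  have h1 := cubicEval_lt_of_unit hP h0
  have h3 : √3 ^ 2 = 3 := Real.sq_sqrt (by norm_num)
  rw [hq, crit_mul_cube] at h1
  rw [hs.eval_eq, hq, mul_pow, h3]
  linarith

/-- The region {h ≥ 0} inside the cone is star-shaped about the axis. After comparison with s²h(q),
the remainder is bounded below using P(y) ≤ 2x³ and 1 + s - 2s² = (1 - s)(1 + 2s). -/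
theorem eval_radial_pos (hs : IsStandardForm h P)
    (hP : ∀ y, ‖y‖ = 1 → cubicEval P y ≤ 2 / (3 * √3)) {q : Ambient n} (hq0 : 0 < q.1)
    (hq : ‖q.2‖ ≤ √3 * q.1) (hh : 0 ≤ cubicEval h q) {s : ℝ} (hs0 : 0 ≤ s) (hs1 : s < 1) :
    0 < cubicEval h (q.1, s • q.2) := by
  have h1 : cubicEval P q.2 ≤ 2 * q.1 ^ 3 := by
    rw [← crit_mul_cube]
    exact (cubicEval_le_of_unit hP q.2).trans (by gcongr)
  have h2 : cubicEval h (q.1, s • q.2) = s ^ 2 * cubicEval h q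
      + (1 - s) * (q.1 ^ 3 * (1 + s) - s ^ 2 * cubicEval P q.2) := by
    rw [hs.eval_eq, hs.eval_eq, cubicEval_smul, norm_smul, mul_pow, Real.norm_eq_abs, sq_abs]
    ring
  have h3 : 0 < q.1 ^ 3 * (1 + s) - s ^ 2 * cubicEval P q.2 := by
    have h4 : s ^ 2 * cubicEval P q.2 ≤ s ^ 2 * (2 * q.1 ^ 3) := by gcongr
    have h5 : 0 < q.1 ^ 3 * ((1 - s) * (1 + 2 * s)) := by
      have : 0 < 1 - s := by linarith
      positivity
    linarith
  have h6 : 0 < (1 - s) * (q.1 ^ 3 * (1 + s) - s ^ 2 * cubicEval P q.2) :=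
    mul_pos (by linarith) h3
  rw [h2]
  positivity

/-! ### Horizontal lines through the cone and hyperbolicity -/

theorem exists_pos_norm_add_smul_eq {E : Type*} [NormedAddCommGroup E] [NormedSpace ℝ E]
    {y w : E} {R : ℝ} (hy : ‖y‖ < R) (hw : w ≠ 0) : ∃ t : ℝ, 0 < t ∧ ‖y + t • w‖ = R := by
  have hw' : 0 < ‖w‖ := norm_pos_iff.2 hw
  have hR : 0 < R := (norm_nonneg y).trans_lt hy
  -- At this parameter ‖tw‖ = R + ‖y‖, so the triangle inequality puts y + tw at norm at least R.
  have ht1 : 0 ≤ (R + ‖y‖) / ‖w‖ := by positivity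
  have hc : Continuous fun t : ℝ => ‖y + t • w‖ := by fun_prop
  have h1 : R ≤ ‖y + ((R + ‖y‖) / ‖w‖) • w‖ := by
    have := norm_sub_norm_le (((R + ‖y‖) / ‖w‖) • w) (-y)
    rw [norm_smul, Real.norm_of_nonneg ht1, div_mul_cancel₀ _ hw'.ne', norm_neg, sub_neg_eq_add,
      add_comm _ y] at this
    linarith
  obtain ⟨t, ⟨ht0, -⟩, ht⟩ := intermediate_value_Icc ht1 hc.continuousOn
    (⟨by simpa using hy.le, h1⟩ : R ∈ Icc _ _)
  refine ⟨t, lt_of_le_of_ne ht0 ?_, ht⟩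
  rintro rfl
  simp only [zero_smul, add_zero] at ht
  linarith

/-- The cone over the component of `{h = 1}` through `(1, 0)`, for `h ∈ 𝒞ₙ`. -/
def standardCone (h : CubicForm (Ambient n)) : Set (Ambient n) :=
  {q | ‖q.2‖ ≤ √3 * q.1 ∧ 0 < cubicEval h q}

theorem norm_lt_of_mem_standardCone (hs : IsStandardForm h P)
    (hP : ∀ y, ‖y‖ = 1 → cubicEval P y ≤ 2 / (3 * √3)) {q : Ambient n}
    (hq : q ∈ standardCone h) : ‖q.2‖ < √3 * q.1 :=
  lt_of_le_of_ne hq.1 fun he => (eval_nonpos_of_norm_eq hs hP he).not_gt hq.2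

theorem fst_pos_of_mem_standardCone (hs : IsStandardForm h P)
    (hP : ∀ y, ‖y‖ = 1 → cubicEval P y ≤ 2 / (3 * √3)) {q : Ambient n}
    (hq : q ∈ standardCone h) : 0 < q.1 := by
  have := (norm_nonneg _).trans_lt (norm_lt_of_mem_standardCone hs hP hq)
  exact pos_of_mul_pos_right this (Real.sqrt_nonneg 3)

/-- Starting where h > 0, a horizontal ray must reach the wall, where h ≤ 0. Applied to w and -w,
this yields roots on both sides. -/
theorem exists_exit (hs : IsStandardForm h P)
    (hP : ∀ y, ‖y‖ = 1 → cubicEval P y ≤ 2 / (3 * √3)) {q : Ambient n} (hq : q ∈ standardCone h)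
    {w : EuclideanSpace ℝ (Fin n)} (hw : w ≠ 0) :
    ∃ t : ℝ, 0 < t ∧ cubicEval h (q + t • ((0, w) : Ambient n)) = 0 := by
  obtain ⟨T, hT, hT'⟩ := exists_pos_norm_add_smul_eq (norm_lt_of_mem_standardCone hs hP hq) hw
  have hc : Continuous fun t : ℝ => cubicEval h (q + t • ((0, w) : Ambient n)) :=
    h.continuous_cubicEval.comp (by fun_prop)
  have h1 : cubicEval h (q + T • ((0, w) : Ambient n)) ≤ 0 :=
    eval_nonpos_of_norm_eq hs hP (by simpa using hT')
  obtain ⟨t, ⟨ht0, -⟩, ht⟩ := intermediate_value_Icc' hT.le hc.continuousOn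
    (⟨h1, by simpa using hq.2.le⟩ : (0 : ℝ) ∈ Icc _ _)
  refine ⟨t, lt_of_le_of_ne ht0 ?_, ht⟩
  rintro rfl
  simp only [zero_smul, add_zero] at ht
  exact hq.2.ne' ht

/-- A cubic with roots on both sides of `0` is real-rooted, and satisfies Newton's inequality. -/
theorem newton_of_roots {A B C D s t : ℝ} (hA : 0 < A) (hs : 0 < s) (ht : 0 < t)
    (h1 : A + 3 * B * t + 3 * C * t ^ 2 + D * t ^ 3 = 0)
    (h2 : A - 3 * B * s + 3 * C * s ^ 2 - D * s ^ 3 = 0) : A * C < B ^ 2 := by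
  have h3 : A * (s ^ 2 - s * t + t ^ 2) + 3 * B * (s - t) * (s * t) + 3 * C * (s * t) ^ 2 = 0 := by
    -- Eliminating D between the two root equations leaves a factor s + t.
    have h4 : (s + t) * (A * (s ^ 2 - s * t + t ^ 2) + 3 * B * (s - t) * (s * t)
        + 3 * C * (s * t) ^ 2) = 0 := by
      linear_combination s ^ 3 * h1 + t ^ 3 * h2
    exact (mul_eq_zero.1 h4).resolve_left (by positivity)
  have h5 : 0 < 12 * (s * t) ^ 2 * (B ^ 2 - A * C) := by
    have : 12 * (s * t) ^ 2 * (B ^ 2 - A * C)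
        = 3 * (2 * (s * t) * B + A * (s - t)) ^ 2 + A ^ 2 * (s + t) ^ 2 := by
      linear_combination (-4 * A) * h3
    rw [this]
    positivity
  have := pos_of_mul_pos_right h5 (by positivity)
  linarith

theorem isHyperbolicPoint_of_mem_standardCone (hs : IsStandardForm h P)
    (hP : ∀ y, ‖y‖ = 1 → cubicEval P y ≤ 2 / (3 * √3)) {q : Ambient n} (hq : q ∈ standardCone h) :
    IsHyperbolicPoint (cubicEval h) q := by
  rw [isHyperbolicPoint_iff]
  refine ⟨hq.2, fun v hv0 hv => ?_⟩
  have hx := fst_pos_of_mem_standardCone hs hP hq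
  have hA : 0 < h.tri q q q := by simpa only [cubicEval_eq] using hq.2
  -- Since q has nonzero first coordinate, every vector is horizontal modulo q.
  set k := v.1 / q.1 with hk
  have hv1 : v = k • q + ((0, v.2 - k • q.2) : Ambient n) := by
    ext1
    · simp [hk, hx.ne']
    · simp
  set w := v.2 - k • q.2
  have hw : w ≠ 0 := by
    intro hw
    rw [hw] at hv1
    have hv1' : v = k • q := hv1.trans (add_zero _)
    rw [hv1'] at hv hv0
    rw [tri_smul_right] at hv
    rcases mul_eq_zero.1 hv with h0 | h0
    · rw [h0] at hv0
      simp at hv0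
    · exact hA.ne' h0
  obtain ⟨t, ht, h1⟩ := exists_exit hs hP hq hw
  obtain ⟨s, hs', h2⟩ := exists_exit hs hP hq (neg_ne_zero.2 hw)
  have hneg : s • ((0, -w) : Ambient n) = (-s) • ((0, w) : Ambient n) := by
    ext1 <;> simp
  rw [hneg] at h2
  rw [cubicEval_add_smul] at h1 h2
  have key := newton_of_roots (C := h.tri q (0, w) (0, w)) (B := h.tri q q (0, w)) hA hs' ht h1
    (by linear_combination h2)
  generalize ((0, w) : Ambient n) = u at *
  rw [hv1] at hv ⊢
  simp only [tri_add_right, tri_add_mid, tri_smul_right, tri_smul_mid, h.tri_swap_right q u q]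
    at hv ⊢
  have hB : h.tri q q u = - (k * h.tri q q q) := by linarith
  rw [hB] at key ⊢
  -- With B = -kA one has h(q,v,v) = C - k²A, and Newton's inequality AC < B² gives its sign.
  have : h.tri q q q * (h.tri q u u - k ^ 2 * h.tri q q q) < 0 := by linarith
  have := neg_of_mul_neg_right this hA.le
  linarith

/-! ### The component of {h = 1} through (1,0) -/

theorem exists_pos_smul_eval_eq_one (h : CubicForm (Ambient n)) {q : Ambient n}
    (hq : 0 < cubicEval h q) : ∃ κ : ℝ, 0 < κ ∧ cubicEval h (κ • q) = 1 := by
  refine ⟨cubicEval h q ^ (-(1 / 3) : ℝ), by positivity, ?_⟩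
  rw [cubicEval_smul, ← Real.rpow_natCast, ← Real.rpow_mul hq.le]
  norm_num
  rw [Real.rpow_neg_one]
  exact inv_mul_cancel₀ hq.ne'

/-- Radial projection of a path in `{h > 0}` stays in a component of `{h = 1}`. -/
theorem smul_mem_standardComponent (h : CubicForm (Ambient n)) {γ : ℝ → Ambient n}
    (hγ : ContinuousOn γ (Icc 0 1)) (hpos : ∀ s ∈ Icc (0 : ℝ) 1, 0 < cubicEval h (γ s))
    {x : ℝ} (h1 : cubicEval h (1, 0) = 1) (h0 : γ 0 = (x, 0)) {κ : ℝ}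
    (hκ1 : cubicEval h (κ • γ 1) = 1) : κ • γ 1 ∈ standardComponent h := by
  let r : ℝ → ℝ := fun s => cubicEval h (γ s) ^ (-(1 / 3) : ℝ)
  have hr : ∀ s ∈ Icc (0 : ℝ) 1, r s ^ 3 * cubicEval h (γ s) = 1 := fun s hs => by
    have hq := hpos s hs
    simp only [r]
    rw [← Real.rpow_natCast, ← Real.rpow_mul hq.le]
    norm_num
    rw [Real.rpow_neg_one]
    exact inv_mul_cancel₀ hq.ne'
  have hcont : ContinuousOn (fun s => r s • γ s) (Icc 0 1) := by
    have hrc : ContinuousOn r (Icc 0 1) := (h.continuous_cubicEval.comp_continuousOn hγ).rpow_const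
      fun s hs => Or.inl (hpos s hs).ne'
    exact hrc.smul hγ
  have hpre := isPreconnected_Icc.image _ hcont
  have hz : (0 : ℝ) ∈ Icc (0 : ℝ) 1 := by simp
  have ho : (1 : ℝ) ∈ Icc (0 : ℝ) 1 := by simp
  have hcube : Function.Injective fun a : ℝ => a ^ 3 := (Odd.strictMono_pow (by decide)).injective
  have hstart : r 0 • γ 0 = (1, 0) := by
    have := hr 0 hz
    have hx3 : cubicEval h (x, 0) = x ^ 3 := by
      have := h.cubicEval_smul x (1, 0)
      rw [h1] at this
      simpa using this
    rw [h0, hx3, ← mul_pow] at this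
    have : r 0 * x = 1 := hcube (by simpa using this)
    rw [h0]
    ext1 <;> simp [this]
  have hend : κ = r 1 := by
    rw [cubicEval_smul] at hκ1
    exact hcube (mul_right_cancel₀ (hpos 1 ho).ne' (hκ1.trans (hr 1 ho).symm))
  refine hpre.subset_connectedComponentIn ⟨0, hz, hstart⟩ ?_ ⟨1, ho, by simp only [hend]⟩
  rintro _ ⟨s, hs, rfl⟩
  simp only [mem_ofPred_eq, cubicEval_smul]
  exact hr s hs

theorem eval_base (hs : IsStandardForm h P) : cubicEval h (1, 0) = 1 := by
  rw [hs.eval_eq]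
  simp [cubicEval_eq]

theorem isOpen_norm_lt (n : ℕ) : IsOpen {q : Ambient n | ‖q.2‖ < √3 * q.1} :=
  isOpen_lt (by fun_prop) (by fun_prop)

theorem isClosed_norm_le (n : ℕ) : IsClosed {q : Ambient n | ‖q.2‖ ≤ √3 * q.1} :=
  isClosed_le (by fun_prop) (by fun_prop)

/-- The wall misses {h = 1}, so a connected subset containing (1,0) cannot leave the cone.
Conversely the path (x, sy), projected radially to {h = 1}, joins any point of the right-hand side
to (1,0). -/
theorem standardComponent_eq (hs : IsStandardForm h P)
    (hP : ∀ y, ‖y‖ = 1 → cubicEval P y ≤ 2 / (3 * √3)) :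
    standardComponent h = {q | ‖q.2‖ ≤ √3 * q.1 ∧ cubicEval h q = 1} := by
  have hbase := eval_base hs
  apply Subset.antisymm
  · have hsub : standardComponent h ⊆ {q | cubicEval h q = 1} := connectedComponentIn_subset _ _
    have hpre : IsPreconnected (standardComponent h) := isPreconnected_connectedComponentIn
    have hcov : standardComponent h ⊆ {q : Ambient n | ‖q.2‖ < √3 * q.1} ∪
        {q : Ambient n | ‖q.2‖ ≤ √3 * q.1}ᶜ := by
      intro q hq
      by_cases hle : ‖q.2‖ ≤ √3 * q.1
      · refine Or.inl (lt_of_le_of_ne hle fun he => ?_)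
        have h1 : cubicEval h q = 1 := hsub hq
        have := eval_nonpos_of_norm_eq hs hP he
        linarith
      · exact Or.inr hle
    have := hpre.subset_left_of_subset_union (isOpen_norm_lt n) (isClosed_norm_le n).isOpen_compl
      (Set.disjoint_left.2 fun q hq hq' => hq' (show ‖q.2‖ ≤ √3 * q.1 from le_of_lt hq)) hcov
      ⟨(1, 0), mem_connectedComponentIn hbase, by simp⟩
    exact fun q hq => ⟨(this hq).le, hsub hq⟩
  · rintro q ⟨hq, hq1⟩
    have hmem : q ∈ standardCone h := ⟨hq, by rw [hq1]; norm_num⟩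
    have hx := fst_pos_of_mem_standardCone hs hP hmem
    have := smul_mem_standardComponent h (γ := fun s => (q.1, s • q.2)) (by fun_prop)
      (fun s hs' => by
        rcases hs'.2.lt_or_eq with h1 | rfl
        · exact eval_radial_pos hs hP hx hq (by rw [hq1]; norm_num) hs'.1 h1
        · simpa using hmem.2) hbase (x := q.1) (by simp) (κ := 1) (by simpa using hq1)
    simpa using this

/-- On {h = 1} the conditions ‖y‖ ≤ √3x and ‖y‖ < √3x agree: the first shows that the component is
closed, the second that it is open in the level set. -/
theorem standardComponent_isCCPSR (hs : IsStandardForm h P)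
    (hP : ∀ y, ‖y‖ = 1 → cubicEval P y ≤ 2 / (3 * √3)) : IsCCPSR h (standardComponent h) := by
  have hmem : ∀ q ∈ standardComponent h, q ∈ standardCone h := fun q hq => by
    rw [standardComponent_eq hs hP] at hq
    exact ⟨hq.1, by rw [hq.2]; norm_num⟩
  have hbase := eval_base hs
  have hhyp : ∀ q ∈ standardComponent h, IsHyperbolicPoint (cubicEval h) q := fun q hq =>
    isHyperbolicPoint_of_mem_standardCone hs hP (hmem q hq)
  refine ⟨⟨⟨_, hhyp _ (mem_connectedComponentIn hbase)⟩,
    ⟨{q | ‖q.2‖ < √3 * q.1}, isOpen_norm_lt n, ?_⟩, hhyp⟩, ?_,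
    isConnected_connectedComponentIn_iff.2 hbase⟩
  · apply Subset.antisymm
    · exact fun q hq => ⟨norm_lt_of_mem_standardCone hs hP (hmem q hq),
        connectedComponentIn_subset _ _ hq⟩
    · rw [standardComponent_eq hs hP]
      exact fun q hq => ⟨hq.1.le, hq.2⟩
  · rw [standardComponent_eq hs hP]
    exact (isClosed_norm_le n).inter
      (isClosed_eq h.continuous_cubicEval continuous_const)

/-! ### The boundary of the cone -/

theorem posCone_standardComponent (hs : IsStandardForm h P)
    (hP : ∀ y, ‖y‖ = 1 → cubicEval P y ≤ 2 / (3 * √3)) :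
    posCone (standardComponent h) = standardCone h := by
  rw [standardComponent_eq hs hP]
  ext q
  constructor
  · rintro ⟨r, hr, p, ⟨hp, hp1⟩, rfl⟩
    refine ⟨?_, ?_⟩
    · simp only [Prod.smul_snd, Prod.smul_fst, norm_smul, Real.norm_of_nonneg hr.le, smul_eq_mul]
      calc r * ‖p.2‖ ≤ r * (√3 * p.1) := by gcongr
        _ = _ := by ring
    · rw [cubicEval_smul, hp1]
      positivity
  · rintro ⟨hq, hq1⟩
    obtain ⟨κ, hκ, hκ1⟩ := exists_pos_smul_eval_eq_one h hq1
    refine ⟨κ⁻¹, inv_pos.2 hκ, κ • q, ⟨?_, hκ1⟩, (inv_smul_smul₀ hκ.ne' q).symm⟩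
    simp only [Prod.smul_snd, Prod.smul_fst, norm_smul, Real.norm_of_nonneg hκ.le, smul_eq_mul]
    calc κ * ‖q.2‖ ≤ κ * (√3 * q.1) := by gcongr
      _ = _ := by ring

theorem isOpen_standardCone (hs : IsStandardForm h P)
    (hP : ∀ y, ‖y‖ = 1 → cubicEval P y ≤ 2 / (3 * √3)) : IsOpen (standardCone h) := by
  have : standardCone h = {q | ‖q.2‖ < √3 * q.1} ∩ {q | 0 < cubicEval h q} :=
    Subset.antisymm (fun q hq => ⟨norm_lt_of_mem_standardCone hs hP hq, hq.2⟩)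
      fun q hq => ⟨hq.1.le, hq.2⟩
  rw [this]
  exact (isOpen_norm_lt n).inter
    (isOpen_lt continuous_const h.continuous_cubicEval)

/-- The weak inequalities pass to the closure. Then x = 0 would force q = 0, and h(q) > 0 would put
q in the open cone. -/
theorem of_mem_frontier_standardCone (hs : IsStandardForm h P)
    (hP : ∀ y, ‖y‖ = 1 → cubicEval P y ≤ 2 / (3 * √3)) {q : Ambient n}
    (hq : q ∈ frontier (standardCone h)) (hq0 : q ≠ 0) :
    0 < q.1 ∧ ‖q.2‖ ≤ √3 * q.1 ∧ cubicEval h q = 0 := by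
  rw [(isOpen_standardCone hs hP).frontier_eq] at hq
  have hcl : IsClosed {q : Ambient n | ‖q.2‖ ≤ √3 * q.1 ∧ 0 ≤ cubicEval h q} :=
    (isClosed_norm_le n).inter
      (isClosed_le continuous_const h.continuous_cubicEval)
  have hsub : standardCone h ⊆ {q : Ambient n | ‖q.2‖ ≤ √3 * q.1 ∧ 0 ≤ cubicEval h q} :=
    fun q hq => ⟨hq.1, hq.2.le⟩
  have h1 : ‖q.2‖ ≤ √3 * q.1 ∧ 0 ≤ cubicEval h q := closure_minimal hsub hcl hq.1
  have hx : 0 ≤ q.1 := by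
    have := (norm_nonneg _).trans h1.1
    exact nonneg_of_mul_nonneg_right this (by positivity)
  refine ⟨lt_of_le_of_ne hx fun h0 => hq0 ?_, h1.1, ?_⟩
  · have h2 := h1.1
    rw [← h0, mul_zero, norm_le_zero_iff] at h2
    exact Prod.ext h0.symm h2
  · by_contra hne
    exact hq.2 ⟨h1.1, lt_of_le_of_ne h1.2 (Ne.symm hne)⟩

/-- The points (x, sy) with s < 1 lie in the cone and tend to q as s → 1. -/
theorem mem_frontier_standardCone (hs : IsStandardForm h P)
    (hP : ∀ y, ‖y‖ = 1 → cubicEval P y ≤ 2 / (3 * √3)) {q : Ambient n} (hx : 0 < q.1)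
    (hq : ‖q.2‖ ≤ √3 * q.1) (hq1 : cubicEval h q = 0) : q ∈ frontier (standardCone h) := by
  rw [(isOpen_standardCone hs hP).frontier_eq]
  refine ⟨?_, fun hmem => hmem.2.ne' hq1⟩
  have hc : Continuous fun s : ℝ => ((q.1, s • q.2) : Ambient n) := by fun_prop
  have ht : Filter.Tendsto (fun s : ℝ => ((q.1, s • q.2) : Ambient n)) (nhdsWithin 1 (Iio 1))
      (nhds q) := by
    simpa using (hc.tendsto 1).mono_left nhdsWithin_le_nhds
  refine mem_closure_of_tendsto ht ?_
  filter_upwards [Ioo_mem_nhdsLT (zero_lt_one' ℝ)] with s hs'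
  refine ⟨?_, eval_radial_pos hs hP hx hq hq1.ge hs'.1.le hs'.2⟩
  simp only [norm_smul, Real.norm_of_nonneg hs'.1.le]
  exact (mul_le_of_le_one_left (norm_nonneg _) hs'.2.le).trans hq

theorem regular_at_frontier (hs : IsStandardForm h P)
    (hP : ∀ y, ‖y‖ = 1 → cubicEval P y < 2 / (3 * √3)) {q : Ambient n} (hx : 0 < q.1)
    (hq : ‖q.2‖ ≤ √3 * q.1) (hq1 : cubicEval h q = 0) :
    (∃ v, h.tri q q v ≠ 0) ∧ ∀ v, h.tri q q v = 0 → h.tri q v v < 0 ∨ ∃ t : ℝ, v = t • q := by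
  have hlt : ‖q.2‖ < √3 * q.1 :=
    lt_of_le_of_ne hq fun he => (eval_neg_of_norm_eq hs hP he hx).ne hq1
  have hq3 : h.tri q q q = 0 := by rwa [cubicEval_eq] at hq1
  constructor
  · refine ⟨(0, q.2), ?_⟩
    have h1 := hs.eval_eq q
    rw [hq1, cubicEval_eq] at h1
    have h2 : 3 * h.tri q q (0, q.2) = q.1 * (‖q.2‖ ^ 2 - 3 * q.1 ^ 2) := by
      rw [hs.tri_eq, real_inner_self_eq_norm_sq]
      linear_combination -3 * h1
    have h3 : ‖q.2‖ ^ 2 < 3 * q.1 ^ 2 := by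
      calc ‖q.2‖ ^ 2 < (√3 * q.1) ^ 2 := by gcongr
        _ = 3 * q.1 ^ 2 := by rw [mul_pow, Real.sq_sqrt (by norm_num)]
    intro h0
    rw [h0, mul_zero] at h2
    have := mul_neg_of_pos_of_neg hx (sub_neg.2 h3)
    linarith
  · intro v hv
    set k := v.1 / q.1 with hk
    have hv1 : v = k • q + ((0, v.2 - k • q.2) : Ambient n) := by
      ext1
      · simp [hk, hx.ne']
      · simp
    set w := v.2 - k • q.2
    by_cases hw : w = 0
    · right
      refine ⟨k, ?_⟩
      rw [hw] at hv1
      exact hv1.trans (add_zero _)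
    · left
      by_contra! hvv
      have hB : h.tri q q (0, w) = 0 := by
        rw [hv1] at hv
        simpa [hq3] using hv
      have hC : 0 ≤ h.tri q (0, w) (0, w) := by
        rw [hv1] at hvv
        simp only [tri_add_right, tri_add_mid, tri_smul_right, tri_smul_mid, hq3, hB,
          h.tri_swap_right q (0, w) q] at hvv
        simpa using hvv
      -- Along q + tu only the t² and t³ terms survive. If both coefficients are nonnegative, h ≥ 0
      -- for t > 0, which contradicts h < 0 on the wall. Replacing w by -w arranges the sign of the
      -- cubic coefficient.
      have key : ∀ u : EuclideanSpace ℝ (Fin n), u ≠ 0 → h.tri q q (0, u) = 0 →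
          0 ≤ h.tri q (0, u) (0, u) → 0 ≤ h.tri (0, u) (0, u) (0, u) → False := by
        intro u hu hB hC hD
        obtain ⟨t, ht, htt⟩ := exists_pos_norm_add_smul_eq hlt hu
        have h1 := eval_neg_of_norm_eq hs hP (q := q + t • ((0, u) : Ambient n))
          (by simpa using htt) (by simpa using hx)
        rw [cubicEval_add_smul, hq3, hB] at h1
        have : 0 ≤ 0 + 3 * 0 * t + 3 * h.tri q (0, u) (0, u) * t ^ 2
            + h.tri (0, u) (0, u) (0, u) * t ^ 3 := by
          have := mul_nonneg hC (sq_nonneg t)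
          have := mul_nonneg hD (pow_pos ht 3).le
          linarith
        linarith
      rcases le_total 0 (h.tri (0, w) (0, w) (0, w)) with hD | hD
      · exact key w hw hB hC hD
      · have hn : ((0, -w) : Ambient n) = (-1 : ℝ) • ((0, w) : Ambient n) := by ext1 <;> simp
        refine key (-w) (neg_ne_zero.2 hw) ?_ ?_ ?_ <;> rw [hn] <;>
          simp only [tri_smul_left, tri_smul_mid, tri_smul_right] <;> linarith

/-- At a maximum of a cubic on the unit sphere, the derivative is radial. -/
theorem tri_of_isMax {E : Type*} [NormedAddCommGroup E] [InnerProductSpace ℝ E]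
    {P : CubicForm E} {u : E} (hu : ‖u‖ = 1) (hpos : 0 ≤ cubicEval P u)
    (hP : ∀ y : E, ‖y‖ = 1 → cubicEval P y ≤ cubicEval P u) (w : E) :
    P.tri u u w = cubicEval P u * inner ℝ u w := by
  have key : ∀ w : E, inner ℝ u w = 0 → P.tri u u w = 0 := by
    intro w hw
    -- P(u + tw) is compared with P(u)‖u + tw‖⁴ instead of the cube. As ‖u + tw‖ ≥ 1 this is still
    -- an upper bound, and it is polynomial in t with no linear term.
    let k : ℝ → ℝ := fun t => cubicEval P u + 3 * P.tri u u w * t + 3 * P.tri u w w * t ^ 2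
      + P.tri w w w * t ^ 3 - cubicEval P u * (1 + t ^ 2 * ‖w‖ ^ 2) ^ 2
    have hk : ∀ t, k t ≤ 0 := by
      intro t
      have h1 := cubicEval_le_of_unit hP (u + t • w)
      have h2 : ‖u + t • w‖ ^ 2 = 1 + t ^ 2 * ‖w‖ ^ 2 := by
        rw [norm_add_sq_real, real_inner_smul_right, hw, hu, norm_smul, mul_pow, Real.norm_eq_abs,
          sq_abs]
        ring
      have h3 : 1 ≤ ‖u + t • w‖ := by
        rw [← one_le_sq_iff₀ (norm_nonneg _), h2]
        have : 0 ≤ t ^ 2 * ‖w‖ ^ 2 := by positivity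
        linarith
      have h4 : ‖u + t • w‖ ^ 3 ≤ (1 + t ^ 2 * ‖w‖ ^ 2) ^ 2 := by
        rw [← h2, ← pow_mul]
        exact pow_le_pow_right₀ h3 (by norm_num)
      have h5 := mul_le_mul_of_nonneg_left h4 hpos
      rw [cubicEval_add_smul] at h1
      simp only [k, cubicEval_eq] at *
      linarith
    have hk0 : k 0 = 0 := by simp [k]
    have hmax : IsLocalMax k 0 := Filter.Eventually.of_forall fun t => by rw [hk0]; exact hk t
    have hid := hasDerivAt_id (0 : ℝ)
    have hd := ((((hid.const_mul (3 * P.tri u u w)).const_add (cubicEval P u)).add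
      ((hid.pow 2).const_mul (3 * P.tri u w w))).add ((hid.pow 3).const_mul (P.tri w w w))).sub
      ((((((hid.pow 2).mul_const (‖w‖ ^ 2)).const_add 1)).pow 2).const_mul (cubicEval P u))
    have hd0 := hmax.hasDerivAt_eq_zero (f' := 3 * P.tri u u w) (hd.congr_deriv (by simp))
    linarith
  have h1 := key (w - (inner ℝ u w : ℝ) • u) (by
    rw [inner_sub_right, real_inner_smul_right, real_inner_self_eq_norm_sq, hu]
    ring)
  rw [sub_eq_add_neg, ← neg_smul, tri_add_right, tri_smul_right] at h1
  rw [cubicEval_eq]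
  linarith

theorem exists_singular_frontier_point (hs : IsStandardForm h P)
    (hP : ∀ y, ‖y‖ = 1 → cubicEval P y ≤ 2 / (3 * √3)) {u : EuclideanSpace ℝ (Fin n)}
    (hu : ‖u‖ = 1) (hPu : cubicEval P u = 2 / (3 * √3)) :
    ∃ p ∈ frontier (standardCone h), p ≠ 0 ∧ ∀ v, h.tri p p v = 0 := by
  have h3 : √3 ^ 2 = 3 := Real.sq_sqrt (by norm_num)
  have h0 : √3 ≠ 0 := by positivity
  have hn : ‖√3 • u‖ = √3 := by rw [norm_smul, hu, Real.norm_of_nonneg (by positivity), mul_one]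
  refine ⟨(1, √3 • u), mem_frontier_standardCone hs hP zero_lt_one ?_ ?_, ?_, fun v => ?_⟩
  · simp [hn]
  · have := crit_mul_cube 1
    rw [mul_one] at this
    rw [hs.eval_eq, cubicEval_smul, hPu, hn]
    simp only
    rw [h3, mul_comm (√3 ^ 3), this]
    norm_num
  · intro h
    exact one_ne_zero (congrArg Prod.fst h)
  · rw [hs.tri_eq]
    simp only [tri_smul_left, tri_smul_mid, real_inner_smul_left, real_inner_smul_right]
    rw [tri_of_isMax hu (by rw [hPu]; positivity) (by rwa [hPu]), hPu,
      real_inner_self_eq_norm_sq, hu]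
    field_simp
    linear_combination (-v.1) * h3

/-! ### The bound on `P` -/

theorem le_of_isHyperbolicPoint (hs : IsStandardForm h P)
    (hhyp : ∀ q ∈ standardComponent h, IsHyperbolicPoint (cubicEval h) q)
    {u : EuclideanSpace ℝ (Fin n)} (hu : ‖u‖ = 1) : cubicEval P u ≤ 2 / (3 * √3) := by
  by_contra! hc
  set c := cubicEval P u with hcdef
  have hc0 : 0 < c := lt_trans (by positivity) hc
  have hc2 : 4 / 27 < c ^ 2 := by
    rw [← crit_sq]
    gcongr
  have hval : ∀ t : ℝ, cubicEval h (1, t • u) = 1 - t ^ 2 + c * t ^ 3 := fun t => by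
    rw [hs.eval_eq, cubicEval_smul, norm_smul, hu, mul_one, Real.norm_eq_abs, sq_abs]
    ring
  have hpos : ∀ t : ℝ, 0 ≤ t → 0 < cubicEval h (1, t • u) := fun t ht => by
    rw [hval]
    -- Here c²(1 - t² + ct³) = (ct - 2/3)²(ct + 1/3) + (c² - 4/27).
    have h1 : 0 < c ^ 2 * (1 - t ^ 2 + c * t ^ 3) := by
      have : 0 ≤ (c * t - 2 / 3) ^ 2 * (c * t + 1 / 3) := by positivity
      nlinarith
    exact pos_of_mul_pos_right h1 (by positivity)
  -- The maximum of t ↦ -1/3 + ct - t²/9, to which AC - B² simplifies; the value there is (27c² -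
  -- 4)/12.
  set τ := 9 * c / 2 with hτ
  have hτ0 : 0 ≤ τ := by positivity
  set a : Ambient n := (1, τ • u) with ha
  obtain ⟨κ, hκ, hκ1⟩ := exists_pos_smul_eval_eq_one h (hpos τ hτ0)
  have hmem : κ • a ∈ standardComponent h := by
    have := smul_mem_standardComponent h (γ := fun s => (1, (s * τ) • u)) (by fun_prop)
      (fun s hs' => hpos _ (mul_nonneg hs'.1 hτ0)) (eval_base hs) (x := 1) (by simp)
      (κ := κ) (by simpa using hκ1)
    simpa [ha] using this
  obtain ⟨-, H⟩ := (h.isHyperbolicPoint_iff _).1 (hhyp _ hmem)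
  set e : Ambient n := (0, u) with he
  have hA : h.tri a a a = 1 - τ ^ 2 + c * τ ^ 3 := by
    rw [← cubicEval_eq, ha, hval]
  have hB : h.tri a a e = -(2 / 3) * τ + c * τ ^ 2 := by
    rw [hs.tri_eq, ha, he]
    simp only [tri_smul_left, tri_smul_mid, real_inner_smul_left,
      real_inner_self_eq_norm_sq, hu, ← cubicEval_eq, ← hcdef]
    ring
  have hC : h.tri a e e = -(1 / 3) + c * τ := by
    rw [hs.tri_eq, ha, he]
    simp only [tri_smul_left, real_inner_self_eq_norm_sq, hu, ← cubicEval_eq, ← hcdef]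
    ring
  have hA0 : 0 < h.tri a a a := by
    rw [← cubicEval_eq]
    exact hpos τ hτ0
  -- A multiple of the projection of e along a to the kernel of h(a,a,·); it gives h(a,v,v) = A(AC -
  -- B²).
  set v := h.tri a a a • e + (-h.tri a a e) • a with hv
  have hav : h.tri a a v = 0 := by
    rw [hv, tri_add_right, tri_smul_right, tri_smul_right]
    ring
  have hv0 : v ≠ 0 := by
    intro h0
    have h1 : v.1 = 0 := by rw [h0]; rfl
    have h2 : h.tri a a e = 0 := by simpa [hv, ha, he] using h1
    have h3 : v.2 = 0 := by rw [h0]; rfl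
    rw [hv, h2] at h3
    have h4 : u = 0 := by
      rw [neg_zero, zero_smul, add_zero] at h3
      exact (smul_eq_zero.1 h3).resolve_left hA0.ne'
    simp [h4] at hu
  have h1 := H v hv0 (by rw [tri_smul_left, tri_smul_mid, hav]; ring)
  rw [tri_smul_left] at h1
  have h2 : h.tri a v v < 0 := neg_of_mul_neg_right h1 hκ.le
  have h3 : h.tri a v v = h.tri a a a * (h.tri a a a * h.tri a e e - h.tri a a e ^ 2) := by
    rw [hv]
    simp only [tri_add_right, tri_add_mid, tri_smul_right, tri_smul_mid, h.tri_swap_right a e a]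
    ring
  rw [h3] at h2
  have h4 := neg_of_mul_neg_right h2 hA0.le
  rw [hA, hB, hC, hτ] at h4
  nlinarith

end StandardForm

end CubicForm

/-! ### The dimension of the space of cubics -/

namespace CubicForm

variable {n : ℕ}

/-- The cubic with prescribed coefficients `h(eᵢ, eⱼ, eₖ)`. -/
noncomputable def ofCoeff (n : ℕ) :
    (Sym (Fin n) 3 → ℝ) →ₗ[ℝ] CubicForm (EuclideanSpace ℝ (Fin n)) where
  toFun c := ofTri (fun x y z => ∑ i, ∑ j, ∑ k, x i * y j * z k * c (i ::ₛ j ::ₛ k ::ₛ Sym.nil))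
    (by intros; simp [add_mul, Finset.sum_add_distrib])
    (by intros; simp [Finset.mul_sum, mul_assoc])
    (by
      intro x y z
      rw [Finset.sum_comm]
      simp only [Sym.cons_swap, mul_comm (x _) (y _)])
    (by
      intro x y z
      refine Finset.sum_congr rfl fun i _ => ?_
      rw [Finset.sum_comm]
      refine Finset.sum_congr rfl fun j _ => Finset.sum_congr rfl fun k _ => ?_
      rw [Sym.cons_swap j k]
      ring)
    (by fun_prop)
  map_add' c d := ext_tri fun x y z => by simp [mul_add, Finset.sum_add_distrib]
  map_smul' t c := ext_tri fun x y z => by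
    simp only [tri_ofTri, tri_smul, RingHom.id_apply, Pi.smul_apply, smul_eq_mul, Finset.mul_sum]
    refine Finset.sum_congr rfl fun i _ => Finset.sum_congr rfl fun j _ =>
      Finset.sum_congr rfl fun k _ => ?_
    ring

theorem tri_ofCoeff (c : Sym (Fin n) 3 → ℝ) (x y z : EuclideanSpace ℝ (Fin n)) :
    (ofCoeff n c).tri x y z
      = ∑ i, ∑ j, ∑ k, x i * y j * z k * c (i ::ₛ j ::ₛ k ::ₛ Sym.nil) := rfl

theorem tri_eq_sum_right (h : CubicForm (EuclideanSpace ℝ (Fin n)))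
    (x y z : EuclideanSpace ℝ (Fin n)) :
    h.tri x y z = ∑ k, z k * h.tri x y (EuclideanSpace.basisFun (Fin n) ℝ k) := by
  rw [← triLin_apply]
  conv_lhs => rw [← (EuclideanSpace.basisFun (Fin n) ℝ).sum_repr z]
  simp only [map_sum, map_smul, triLin_apply, smul_eq_mul, EuclideanSpace.basisFun_repr]

theorem tri_eq_sum (h : CubicForm (EuclideanSpace ℝ (Fin n)))
    (x y z : EuclideanSpace ℝ (Fin n)) :
    h.tri x y z = ∑ i, ∑ j, ∑ k, x i * y j * z k * h.tri (EuclideanSpace.basisFun (Fin n) ℝ i)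
      (EuclideanSpace.basisFun (Fin n) ℝ j) (EuclideanSpace.basisFun (Fin n) ℝ k) := by
  rw [h.tri_swap_left x, h.tri_swap_right y, h.tri_eq_sum_right y z x]
  refine Finset.sum_congr rfl fun i _ => ?_
  rw [h.tri_swap_left y, h.tri_swap_right z, h.tri_eq_sum_right z _ y, Finset.mul_sum]
  refine Finset.sum_congr rfl fun j _ => ?_
  rw [h.tri_swap_left z, h.tri_swap_right _ z, h.tri_eq_sum_right _ _ z, Finset.mul_sum, Finset.mul_sum]
  refine Finset.sum_congr rfl fun k _ => ?_
  ring

theorem exists_sym_eq (s : Sym (Fin n) 3) : ∃ i j k, s = i ::ₛ j ::ₛ k ::ₛ Sym.nil := by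
  obtain ⟨i, s, rfl⟩ := s.exists_eq_cons_of_succ
  obtain ⟨j, s, rfl⟩ := s.exists_eq_cons_of_succ
  obtain ⟨k, s, rfl⟩ := s.exists_eq_cons_of_succ
  exact ⟨i, j, k, by rw [s.eq_nil_of_card_zero]⟩

theorem ofCoeff_bijective : Function.Bijective (ofCoeff n) := by
  constructor
  · intro c d hcd
    funext s
    obtain ⟨i, j, k, rfl⟩ := exists_sym_eq s
    have := congrArg (fun h => h.tri (EuclideanSpace.basisFun (Fin n) ℝ i)
      (EuclideanSpace.basisFun (Fin n) ℝ j) (EuclideanSpace.basisFun (Fin n) ℝ k)) hcd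
    simpa [tri_ofCoeff, Finset.sum_ite_eq] using this
  · intro h
    let e : Fin n → EuclideanSpace ℝ (Fin n) := EuclideanSpace.basisFun (Fin n) ℝ
    -- The polarization formula written symmetrically in the multiset: pair sums are the total minus
    -- one element, so no ordering has to be chosen.
    let c : Sym (Fin n) 3 → ℝ := fun s =>
      (cubicEval h ((s : Multiset (Fin n)).map e).sum
        - ((s : Multiset (Fin n)).map fun i =>
            cubicEval h (((s : Multiset (Fin n)).map e).sum - e i)).sum
        + ((s : Multiset (Fin n)).map fun i => cubicEval h (e i)).sum) / 6
    refine ⟨c, ext_tri fun x y z => ?_⟩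
    rw [tri_ofCoeff, tri_eq_sum]
    refine Finset.sum_congr rfl fun i _ => Finset.sum_congr rfl fun j _ =>
      Finset.sum_congr rfl fun k _ => ?_
    congr 1
    have h1 := h.tri_polarization (e i) (e j) (e k)
    have e1 : e i + (e j + e k) - e i = e j + e k := by abel
    have e2 : e i + (e j + e k) - e j = e i + e k := by abel
    have e3 : e i + (e j + e k) - e k = e i + e j := by abel
    have e4 : e i + e j + e k = e i + (e j + e k) := by abel
    have h2 : c (i ::ₛ j ::ₛ k ::ₛ Sym.nil) = (cubicEval h (e i + (e j + e k))
        - (cubicEval h (e j + e k) + (cubicEval h (e i + e k) + cubicEval h (e i + e j)))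
        + (cubicEval h (e i) + (cubicEval h (e j) + cubicEval h (e k)))) / 6 := by
      have hm : ((i ::ₛ j ::ₛ k ::ₛ Sym.nil : Sym (Fin n) 3) : Multiset (Fin n))
          = i ::ₘ j ::ₘ k ::ₘ 0 := rfl
      simp [c, hm, e1, e2, e3]
    rw [h2]
    rw [e4] at h1
    change _ = h.tri (e i) (e j) (e k)
    linarith

theorem finrank_cubicForm (n : ℕ) :
    finrank ℝ (CubicForm (EuclideanSpace ℝ (Fin n))) = (n ^ 3 + 3 * n ^ 2 + 2 * n) / 6 := by
  rw [← (LinearEquiv.ofBijective (ofCoeff n) ofCoeff_bijective).finrank_eq,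
    Module.finrank_fintype_fun_eq_card, Sym.card_sym_eq_choose, Fintype.card_fin,
    Nat.choose_eq_descFactorial_div_factorial]
  have h1 : n + 3 - 1 = n + 2 := by omega
  have h2 : (n + 2).descFactorial 3 = n ^ 3 + 3 * n ^ 2 + 2 * n := by
    simp [Nat.descFactorial_succ]
    ring
  rw [h1, h2]
  rfl

/-! ### The affine space of standard forms -/

/-- `P ↦ P(y)`, as a cubic in `(x, y)`. -/
noncomputable def extend (n : ℕ) :
    CubicForm (EuclideanSpace ℝ (Fin n)) →L[ℝ] CubicForm (Ambient n) :=
  (pullback (ContinuousLinearMap.snd ℝ ℝ (EuclideanSpace ℝ (Fin n)))).toContinuousLinearMap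

/-- Restriction of a cubic to `{x = 0}`. -/
noncomputable def restrictSnd (n : ℕ) :
    CubicForm (Ambient n) →L[ℝ] CubicForm (EuclideanSpace ℝ (Fin n)) :=
  (pullback (ContinuousLinearMap.inr ℝ ℝ (EuclideanSpace ℝ (Fin n)))).toContinuousLinearMap

@[simp] theorem restrictSnd_extend (P : CubicForm (EuclideanSpace ℝ (Fin n))) :
    restrictSnd n (extend n P) = P :=
  ext_tri fun _ _ _ => rfl

@[simp] theorem restrictSnd_standardCubic : restrictSnd n (standardCubic n) = 0 :=
  ext_tri fun a b c => by
    change (standardCubic n).tri (0, a) (0, b) (0, c) = 0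
    simp [tri_standardCubic]

theorem isStandardForm_iff_extend {h : CubicForm (Ambient n)}
    {P : CubicForm (EuclideanSpace ℝ (Fin n))} :
    IsStandardForm h P ↔ h = standardCubic n + extend n P :=
  isStandardForm_iff

theorem extend_injective (n : ℕ) : Function.Injective (extend n) :=
  Function.LeftInverse.injective restrictSnd_extend

theorem mem_standardSpace {h : CubicForm (Ambient n)} :
    h ∈ standardSpace n ↔ ∃ P, h = standardCubic n + extend n P :=
  exists_congr fun _ => isStandardForm_iff_extend

theorem direction_standardSpace (n : ℕ) :
    (standardSpace n).direction = LinearMap.range (extend n).toLinearMap := by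
  ext v
  have h0 : standardCubic n ∈ standardSpace n := mem_standardSpace.2 ⟨0, by simp⟩
  rw [AffineSubspace.mem_direction_iff_eq_vsub_right h0, LinearMap.mem_range]
  constructor
  · rintro ⟨h, hh, rfl⟩
    obtain ⟨P, rfl⟩ := mem_standardSpace.1 hh
    exact ⟨P, by simp⟩
  · rintro ⟨P, rfl⟩
    exact ⟨_, mem_standardSpace.2 ⟨P, rfl⟩, by simp⟩

/-- The direction of the affine space of standard forms is the space of cubics in `y`. -/
noncomputable def directionEquiv (n : ℕ) :
    CubicForm (EuclideanSpace ℝ (Fin n)) ≃ₗ[ℝ] (standardSpace n).direction :=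
  (LinearEquiv.ofInjective (extend n).toLinearMap (extend_injective n)).trans
    (LinearEquiv.ofEq _ _ (direction_standardSpace n).symm)

/-- The affine space of standard forms is homeomorphic to the space of cubics in `y`. -/
noncomputable def standardSpaceHomeomorph (n : ℕ) :
    standardSpace n ≃ₜ CubicForm (EuclideanSpace ℝ (Fin n)) where
  toFun h := restrictSnd n h
  invFun P := ⟨standardCubic n + extend n P, mem_standardSpace.2 ⟨P, rfl⟩⟩
  left_inv h := by
    obtain ⟨P, hP⟩ := mem_standardSpace.1 h.2
    apply Subtype.ext
    simp [hP]
  right_inv P := by simp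
  continuous_toFun := (restrictSnd n).continuous.comp continuous_subtype_val
  continuous_invFun := (continuous_const.add (extend n).continuous).subtype_mk _

/-! ### The convex body of cubics bounded on the sphere -/

section Body

variable {E : Type*} [NormedAddCommGroup E] [NormedSpace ℝ E]

/-- The cubics bounded above by `C` on the unit sphere. -/
def sphereBounded (E : Type*) [NormedAddCommGroup E] [NormedSpace ℝ E] (C : ℝ) :
    Set (CubicForm E) :=
  {P | ∀ y : E, ‖y‖ = 1 → cubicEval P y ≤ C}

theorem convex_sphereBounded (C : ℝ) : Convex ℝ (sphereBounded E C) := by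
  intro P hP Q hQ a b ha hb hab y hy
  rw [cubicEval_add, cubicEval_const_smul, cubicEval_const_smul]
  calc a * cubicEval P y + b * cubicEval Q y ≤ a * C + b * C := by
        gcongr
        exacts [hP y hy, hQ y hy]
    _ = C := by rw [← add_mul, hab, one_mul]

theorem abs_cubicEval_le (P : CubicForm E) {y : E} (hy : ‖y‖ = 1) : |cubicEval P y| ≤ ‖P‖ := by
  have : |cubicEval P y| ≤ _ := P.1.le_opNorm (fun _ => y)
  simpa [hy] using this

theorem isClosed_sphereBounded (C : ℝ) : IsClosed (sphereBounded E C) := by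
  have : sphereBounded E C = ⋂ (y : E) (_ : ‖y‖ = 1), {P | cubicEval P y ≤ C} := by
    ext P
    simp [sphereBounded]
  rw [this]
  refine isClosed_iInter fun y => isClosed_iInter fun _ => isClosed_le ?_ continuous_const
  exact (ContinuousEvalConst.continuous_eval_const (fun _ : Fin 3 => y)).comp continuous_subtype_val

/-- Evaluation at a unit vector is 1-Lipschitz in the cubic, so the ball of radius C - c around P
fits. -/
theorem sphereBounded_mem_nhds {C c : ℝ} {P : CubicForm E} (hc : c < C)
    (hP : ∀ y : E, ‖y‖ = 1 → cubicEval P y ≤ c) : sphereBounded E C ∈ nhds P := by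
  refine Filter.mem_of_superset (Metric.ball_mem_nhds P (sub_pos.2 hc)) fun Q hQ y hy => ?_
  rw [mem_ball_iff_norm] at hQ
  have h1 := (le_abs_self _).trans (abs_cubicEval_le (Q - P) hy)
  rw [cubicEval_sub] at h1
  linarith [hP y hy]

theorem isBounded_sphereBounded {C : ℝ} (hC : 0 ≤ C) :
    Bornology.IsBounded (sphereBounded E C) := by
  -- Oddness makes the bound on P two-sided. Polarization on unit vectors then gives (27 + 3·8 +
  -- 3)C/6 = 9C.
  refine (isBounded_iff_forall_norm_le).2 ⟨9 * C, fun P hP => ?_⟩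
  have habs : ∀ (y : E) (r : ℝ), ‖y‖ ≤ r → |cubicEval P y| ≤ C * r ^ 3 := by
    intro y r hr
    refine le_trans (abs_le'.2 ⟨cubicEval_le_of_unit hP y, ?_⟩) (by gcongr : C * ‖y‖ ^ 3 ≤ _)
    rw [← cubicEval_neg, ← norm_neg y]
    exact cubicEval_le_of_unit hP (-y)
  have hunit : ∀ a b c : E, ‖a‖ ≤ 1 → ‖b‖ ≤ 1 → ‖c‖ ≤ 1 → |P.tri a b c| ≤ 9 * C := by
    intro a b c ha hb hc
    have h1 := P.tri_polarization a b c
    have hab := (norm_add_le a b).trans (add_le_add ha hb)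
    have hac := (norm_add_le a c).trans (add_le_add ha hc)
    have hbc := (norm_add_le b c).trans (add_le_add hb hc)
    have habc := (norm_add_le (a + b) c).trans (add_le_add hab hc)
    have i1 := abs_le.1 (habs _ _ habc)
    have i2 := abs_le.1 (habs _ _ hab)
    have i3 := abs_le.1 (habs _ _ hac)
    have i4 := abs_le.1 (habs _ _ hbc)
    have i5 := abs_le.1 (habs _ _ ha)
    have i6 := abs_le.1 (habs _ _ hb)
    have i7 := abs_le.1 (habs _ _ hc)
    rw [abs_le]
    constructor <;> linarith [i1.1, i1.2, i2.1, i2.2, i3.1, i3.2, i4.1, i4.2, i5.1, i5.2, i6.1,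
      i6.2, i7.1, i7.2]
  have hdecomp : ∀ v : E, ∃ u : E, ‖u‖ ≤ 1 ∧ v = ‖v‖ • u := by
    intro v
    rcases eq_or_ne v 0 with rfl | hv
    · exact ⟨0, by simp, by simp⟩
    · refine ⟨‖v‖⁻¹ • v, ?_, (smul_inv_smul₀ (norm_ne_zero_iff.2 hv) v).symm⟩
      rw [norm_smul, norm_inv, norm_norm, inv_mul_cancel₀ (norm_ne_zero_iff.2 hv)]
  refine P.1.opNorm_le_bound (by positivity) fun v => ?_
  obtain ⟨a, ha, hva⟩ := hdecomp (v 0)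
  obtain ⟨b, hb, hvb⟩ := hdecomp (v 1)
  obtain ⟨c, hc, hvc⟩ := hdecomp (v 2)
  rw [apply_eq_tri, Fin.prod_univ_three, Real.norm_eq_abs]
  conv_lhs => rw [hva, hvb, hvc, tri_smul_left, tri_smul_mid, tri_smul_right]
  rw [abs_mul, abs_mul, abs_mul, abs_norm, abs_norm, abs_norm]
  calc ‖v 0‖ * (‖v 1‖ * (‖v 2‖ * |P.tri a b c|)) ≤ ‖v 0‖ * (‖v 1‖ * (‖v 2‖ * (9 * C))) := by
        gcongr
        exact hunit a b c ha hb hc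
    _ = _ := by ring

theorem mem_frontier_sphereBounded [FiniteDimensional ℝ E] {C : ℝ} (hC : 0 < C)
    {P : CubicForm E} :
    P ∈ frontier (sphereBounded E C) ↔
      P ∈ sphereBounded E C ∧ ∃ u : E, ‖u‖ = 1 ∧ cubicEval P u = C := by
  have hcl := isClosed_sphereBounded (E := E) C
  rw [hcl.frontier_eq, mem_sdiff]
  refine and_congr_right fun hP => ⟨fun hint => ?_, ?_⟩
  · by_contra! hne
    have hlt : ∀ u : E, ‖u‖ = 1 → cubicEval P u < C := fun u hu =>
      lt_of_le_of_ne (hP u hu) (hne u hu)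
    refine hint (mem_interior_iff_mem_nhds.2 ?_)
    rcases (Metric.sphere (0 : E) 1).eq_empty_or_nonempty with he | hne
    · refine sphereBounded_mem_nhds hC fun y hy => ?_
      have : y ∈ Metric.sphere (0 : E) 1 := by simpa using hy
      simp [he] at this
    · have : ProperSpace E := FiniteDimensional.proper_real E
      obtain ⟨u, hu, hmax⟩ := (isCompact_sphere (0 : E) 1).exists_isMaxOn hne
        P.continuous_cubicEval.continuousOn
      exact sphereBounded_mem_nhds (hlt u (by simpa using hu))
        fun y hy => hmax (by simpa using hy)
  · rintro ⟨u, hu, hPu⟩ hint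
    -- If P attains C > 0, then tP violates the bound for every t > 1, so P is not interior.
    have hc : Continuous fun t : ℝ => t • P := continuous_id.smul continuous_const
    have h1 : ∀ᶠ t in nhdsWithin (1 : ℝ) (Ioi 1), t • P ∈ sphereBounded E C := by
      have : sphereBounded E C ∈ nhds ((1 : ℝ) • P) := by
        rw [one_smul]
        exact mem_interior_iff_mem_nhds.1 hint
      exact (hc.continuousAt.eventually this).filter_mono nhdsWithin_le_nhds
    obtain ⟨t, ht, ht1⟩ := (h1.and self_mem_nhdsWithin).exists
    have h2 := ht u hu
    rw [cubicEval_const_smul, hPu] at h2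
    have h3 := mul_lt_mul_of_pos_right (show 1 < t from ht1) hC
    linarith

end Body

end CubicForm

/-! ### Locally flat submanifolds -/

section Submanifold

variable {V : Type*} [NormedAddCommGroup V] [NormedSpace ℝ V]

/-- Radial rescaling carries the level sets of a positively homogeneous function to
hyperplanes. -/
noncomputable def radialChart (g : V → ℝ) (hg : Continuous g)
    (hsmul : ∀ (t : ℝ) (x : V), 0 ≤ t → g (t • x) = t * g x) (hpos : ∀ x ≠ 0, 0 < g x)
    (φ : V →L[ℝ] ℝ) : OpenPartialHomeomorph V V where
  toFun x := (g x / φ x) • x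
  invFun z := (φ z / g z) • z
  source := {x | 0 < φ x}
  target := {x | 0 < φ x}
  map_source' x hx := by
    have hx' : 0 < φ x := hx
    have hg : 0 < g x := hpos x fun h0 => by simp [h0] at hx'
    change 0 < φ ((g x / φ x) • x)
    rw [map_smul, smul_eq_mul]
    positivity
  map_target' x hx := by
    have hx' : 0 < φ x := hx
    have hg : 0 < g x := hpos x fun h0 => by simp [h0] at hx'
    change 0 < φ ((φ x / g x) • x)
    rw [map_smul, smul_eq_mul]
    positivity
  left_inv' x hx := by
    have hx' : 0 < φ x := hx
    have hg : 0 < g x := hpos x fun h0 => by simp [h0] at hx'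
    rw [map_smul, hsmul _ _ (by positivity), smul_smul, smul_eq_mul]
    convert one_smul ℝ x
    field_simp
  right_inv' x hx := by
    have hx' : 0 < φ x := hx
    have hg : 0 < g x := hpos x fun h0 => by simp [h0] at hx'
    rw [map_smul, hsmul _ _ (by positivity), smul_smul, smul_eq_mul]
    convert one_smul ℝ x
    field_simp
  open_source := isOpen_lt continuous_const φ.continuous
  open_target := isOpen_lt continuous_const φ.continuous
  continuousOn_toFun := by
    refine ContinuousOn.smul (ContinuousOn.div hg.continuousOn φ.continuous.continuousOn ?_)
      continuousOn_id
    exact fun x hx => ne_of_gt hx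
  continuousOn_invFun := by
    refine ContinuousOn.smul (ContinuousOn.div φ.continuous.continuousOn hg.continuousOn ?_)
      continuousOn_id
    intro x hx
    have hx' : 0 < φ x := hx
    exact (hpos x fun h0 => by simp [h0] at hx').ne'

/-- The boundary of a convex body is a locally flat hypersurface. -/
theorem isTopSubmanifold_frontier [FiniteDimensional ℝ V] {s : Set V} (hc : Convex ℝ s)
    (h0 : s ∈ nhds 0) (hb : Bornology.IsBounded s) :
    IsTopSubmanifold V (frontier s) (finrank ℝ V - 1) := by
  intro p hp
  have habs : Absorbent ℝ s := absorbent_nhds_zero h0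
  have hvb : Bornology.IsVonNBounded ℝ s := NormedSpace.isVonNBounded_of_isBounded ℝ hb
  rw [← gauge_eq_one_iff_mem_frontier hc h0] at hp
  have hp0 : p ≠ 0 := by
    rintro rfl
    simp at hp
  obtain ⟨φ, hφ⟩ := SeparatingDual.exists_eq_one (R := ℝ) hp0
  have hsm : ∀ (t : ℝ) (x : V), 0 ≤ t → gauge s (t • x) = t * gauge s x := fun t x ht => by
    rw [gauge_smul_of_nonneg ht, smul_eq_mul]
  let e := radialChart (gauge s) (continuous_gauge hc h0) hsm
    (fun x hx => (gauge_pos habs hvb).2 hx) φ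
  -- The radial chart satisfies φ(e(x)) = gauge(x), so the frontier goes to φ = 1; translation by
  -- -p, where φ(p) = 1, moves this to ker φ.
  refine ⟨e.transHomeomorph (Homeomorph.addRight (-p)), LinearMap.ker φ.toLinearMap, ?_, ?_, ?_⟩
  · change 0 < φ p
    rw [hφ]
    exact one_pos
  · have hne : φ.toLinearMap ≠ 0 := fun h => by
      have : φ.toLinearMap p = 0 := by rw [h]; rfl
      exact one_ne_zero (hφ.symm.trans this)
    have := Module.Dual.finrank_ker_add_one_of_ne_zero hne
    omega
  · intro q hq
    have hq' : 0 < φ q := hq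
    change q ∈ frontier s ↔ φ ((gauge s q / φ q) • q + -p) = 0
    rw [← gauge_eq_one_iff_mem_frontier hc h0, map_add, map_neg, hφ, map_smul, smul_eq_mul,
      div_mul_cancel₀ _ hq'.ne', ← sub_eq_add_neg, sub_eq_zero]

theorem IsTopSubmanifold.preimage {X X' V V' : Type*} [TopologicalSpace X] [TopologicalSpace X']
    [AddCommGroup V] [Module ℝ V] [TopologicalSpace V]
    [AddCommGroup V'] [Module ℝ V'] [TopologicalSpace V'] {S : Set X} {d : ℕ}
    (hS : IsTopSubmanifold V S d) (τ : X' ≃ₜ X) (L : V ≃L[ℝ] V') :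
    IsTopSubmanifold V' (τ ⁻¹' S) d := by
  intro p hp
  obtain ⟨e, W, hpe, hW, he⟩ := hS (τ p) hp
  refine ⟨(τ.transOpenPartialHomeomorph e).transHomeomorph L.toHomeomorph,
    W.map L.toLinearEquiv.toLinearMap, hpe, ?_, fun q hq => ?_⟩
  · rw [← hW]
    exact LinearEquiv.finrank_map_eq L.toLinearEquiv W
  · refine (he (τ q) hq).trans ?_
    change _ ↔ L (e (τ q)) ∈ _
    constructor
    · exact fun h => ⟨_, h, rfl⟩
    · rintro ⟨w, hw, hw'⟩
      rwa [← L.injective hw']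

theorem IsTopSubmanifold.prod_zero {X V K : Type*} [TopologicalSpace X]
    [AddCommGroup V] [Module ℝ V] [TopologicalSpace V]
    [AddCommGroup K] [Module ℝ K] [TopologicalSpace K] {S : Set X} {d : ℕ}
    (hS : IsTopSubmanifold V S d) : IsTopSubmanifold (V × K) (S ×ˢ ({0} : Set K)) d := by
  intro p hp
  obtain ⟨e, W, hpe, hW, he⟩ := hS p.1 hp.1
  refine ⟨e.prod (OpenPartialHomeomorph.refl K), W.map (LinearMap.inl ℝ V K), ⟨hpe, mem_univ _⟩,
    ?_, fun q hq => ?_⟩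
  · rw [← hW]
    exact (W.equivMapOfInjective _ LinearMap.inl_injective).finrank_eq.symm
  · rw [mem_prod, he q.1 hq.1, mem_singleton_iff]
    change _ ↔ (e q.1, q.2) ∈ _
    constructor
    · rintro ⟨h1, h2⟩
      exact ⟨_, h1, by rw [h2]; rfl⟩
    · rintro ⟨w, hw, hw'⟩
      have h1 : w = e q.1 := congrArg Prod.fst hw'
      exact ⟨h1 ▸ hw, (congrArg Prod.snd hw').symm⟩

end Submanifold

/-! ### The generating set and its boundary -/

namespace CubicForm

variable {n : ℕ}

theorem mem_generatingSet {h : CubicForm (Ambient n)} :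
    h ∈ generatingSet n ↔ ∃ P ∈ sphereBounded (EuclideanSpace ℝ (Fin n)) (2 / (3 * √3)),
      h = standardCubic n + extend n P := by
  constructor
  · rintro ⟨P, hs, hP⟩
    exact ⟨P, hP, isStandardForm_iff_extend.1 hs⟩
  · rintro ⟨P, hP, hs⟩
    exact ⟨P, isStandardForm_iff_extend.2 hs, hP⟩

theorem generatingSet_eq_image (n : ℕ) :
    generatingSet n = (fun P => standardCubic n + extend n P) ''
      sphereBounded (EuclideanSpace ℝ (Fin n)) (2 / (3 * √3)) := by
  ext h
  rw [mem_generatingSet]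
  exact exists_congr fun P => and_congr_right fun _ => eq_comm

theorem isCompact_generatingSet (n : ℕ) : IsCompact (generatingSet n) := by
  rw [generatingSet_eq_image]
  have : ProperSpace (CubicForm (EuclideanSpace ℝ (Fin n))) := FiniteDimensional.proper_real _
  exact (Metric.isCompact_of_isClosed_isBounded (isClosed_sphereBounded _)
    (isBounded_sphereBounded (by positivity))).image
      (continuous_const.add (extend n).continuous)

theorem convex_generatingSet (n : ℕ) : Convex ℝ (generatingSet n) := by
  have : generatingSet n = (fun h => standardCubic n + h) '' ((extend n).toLinearMap ''
      sphereBounded (EuclideanSpace ℝ (Fin n)) (2 / (3 * √3))) := by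
    rw [generatingSet_eq_image, image_image]
    rfl
  rw [this]
  exact ((convex_sphereBounded _).linear_image _).translate _

theorem frontier_generatingSetIn (n : ℕ) :
    frontier (generatingSetIn n) = standardSpaceHomeomorph n ⁻¹'
      frontier (sphereBounded (EuclideanSpace ℝ (Fin n)) (2 / (3 * √3))) := by
  rw [(standardSpaceHomeomorph n).preimage_frontier]
  congr 1
  ext h
  change (h : CubicForm (Ambient n)) ∈ generatingSet n ↔ restrictSnd n h ∈ sphereBounded _ _
  obtain ⟨Q, hQ⟩ := mem_standardSpace.1 h.2
  rw [mem_generatingSet, hQ]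
  constructor
  · rintro ⟨P, hP, h1⟩
    rw [add_right_inj] at h1
    simpa [extend_injective n h1] using hP
  · intro hQ'
    exact ⟨Q, by simpa using hQ', rfl⟩

theorem mem_generatingBoundary {h : CubicForm (Ambient n)} :
    h ∈ generatingBoundary n ↔
      ∃ P ∈ frontier (sphereBounded (EuclideanSpace ℝ (Fin n)) (2 / (3 * √3))),
        h = standardCubic n + extend n P := by
  unfold generatingBoundary
  rw [frontier_generatingSetIn]
  constructor
  · rintro ⟨h, hh, rfl⟩
    obtain ⟨P, hP⟩ := mem_standardSpace.1 h.2
    refine ⟨P, ?_, hP⟩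
    have h1 : restrictSnd n h ∈ frontier _ := hh
    rw [hP] at h1
    simpa using h1
  · rintro ⟨P, hP, rfl⟩
    refine ⟨⟨_, mem_standardSpace.2 ⟨P, rfl⟩⟩, ?_, rfl⟩
    change restrictSnd n (standardCubic n + extend n P) ∈ frontier _
    simpa using hP

theorem mem_generatingBoundary_iff {h : CubicForm (Ambient n)}
    {P : CubicForm (EuclideanSpace ℝ (Fin n))} (hs : IsStandardForm h P)
    (hP : ∀ y, ‖y‖ = 1 → cubicEval P y ≤ 2 / (3 * √3)) :
    h ∈ generatingBoundary n ↔ ∃ u, ‖u‖ = 1 ∧ cubicEval P u = 2 / (3 * √3) := by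
  rw [mem_generatingBoundary]
  have hs' := isStandardForm_iff_extend.1 hs
  constructor
  · rintro ⟨Q, hQ, hhQ⟩
    rw [hs', add_right_inj] at hhQ
    rw [extend_injective n hhQ]
    exact ((mem_frontier_sphereBounded (by positivity)).1 hQ).2
  · exact fun hu => ⟨P, (mem_frontier_sphereBounded (by positivity)).2 ⟨hP, hu⟩, hs'⟩

theorem isTopSubmanifold_frontier_sphereBounded (n : ℕ) :
    IsTopSubmanifold (CubicForm (EuclideanSpace ℝ (Fin n)))
      (frontier (sphereBounded (EuclideanSpace ℝ (Fin n)) (2 / (3 * √3))))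
      ((n ^ 3 + 3 * n ^ 2 + 2 * n) / 6 - 1) := by
  have hpos : (0 : ℝ) < 2 / (3 * √3) := by positivity
  have h0 : sphereBounded (EuclideanSpace ℝ (Fin n)) (2 / (3 * √3)) ∈ nhds 0 :=
    sphereBounded_mem_nhds hpos fun y _ => by simp [cubicEval_eq]
  have hc := convex_sphereBounded (E := EuclideanSpace ℝ (Fin n)) (2 / (3 * √3))
  have hb := isBounded_sphereBounded (E := EuclideanSpace ℝ (Fin n)) hpos.le
  rw [← finrank_cubicForm]
  generalize sphereBounded (EuclideanSpace ℝ (Fin n)) (2 / (3 * √3)) = s at *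
  exact isTopSubmanifold_frontier (V := CubicForm (EuclideanSpace ℝ (Fin n))) (s := s) hc h0 hb

theorem isTopSubmanifold_frontier_generatingSetIn (n : ℕ) :
    IsTopSubmanifold (standardSpace n).direction (frontier (generatingSetIn n))
      ((n ^ 3 + 3 * n ^ 2 + 2 * n) / 6 - 1) := by
  rw [frontier_generatingSetIn]
  exact (isTopSubmanifold_frontier_sphereBounded n).preimage (standardSpaceHomeomorph n)
    (directionEquiv n).toContinuousLinearEquiv

theorem isTopSubmanifold_generatingBoundary (n : ℕ) :
    IsTopSubmanifold (CubicForm (Ambient n)) (generatingBoundary n)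
      ((n ^ 3 + 3 * n ^ 2 + 2 * n) / 6 - 1) := by
  -- The space of cubics splits as the cubics in y times the kernel of restriction to x = 0; after
  -- translation the boundary is the frontier of the body times {0}.
  let Ψ := ContinuousLinearEquiv.equivOfRightInverse (restrictSnd n) (extend n) restrictSnd_extend
  let τ := (Homeomorph.addRight (-standardCubic n)).trans Ψ.toHomeomorph
  have : generatingBoundary n = τ ⁻¹'
      (frontier (sphereBounded (EuclideanSpace ℝ (Fin n)) (2 / (3 * √3))) ×ˢ {0}) := by
    ext h
    rw [mem_generatingBoundary, mem_preimage, mem_prod, mem_singleton_iff]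
    have h1 : (τ h).1 = restrictSnd n (h + -standardCubic n) := rfl
    have h2 : ((τ h).2 : CubicForm (Ambient n)) = (h + -standardCubic n)
      - extend n (restrictSnd n (h + -standardCubic n)) := rfl
    rw [← Submodule.coe_eq_zero, h1, h2]
    constructor
    · rintro ⟨P, hP, rfl⟩
      constructor
      · simpa using hP
      · simp
    · rintro ⟨hP, h0⟩
      exact ⟨_, hP, by rw [← sub_eq_zero.1 h0]; abel⟩
  rw [this]
  exact (isTopSubmanifold_frontier_sphereBounded n).prod_zero.preimage τ Ψ.symm

/-! ### Equivalence with standard components -/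

/-- H is open and closed in {h = 1} as well as connected. This lets an equivalence be tracked by a
single base point. -/
theorem _root_.IsCCPSR.eq_connectedComponentIn {h : CubicForm (Ambient n)} {H : Set (Ambient n)}
    (hH : IsCCPSR h H) {p : Ambient n} (hp : p ∈ H) :
    H = connectedComponentIn {q | cubicEval h q = 1} p := by
  obtain ⟨O, hO, hHO⟩ := hH.isOpen_in_level
  have hsub : H ⊆ {q | cubicEval h q = 1} := by
    rw [hHO]
    exact inter_subset_right
  apply Subset.antisymm
  · exact hH.isConnected.isPreconnected.subset_connectedComponentIn hp hsub
  · have hpre : IsPreconnected (connectedComponentIn {q | cubicEval h q = 1} p) :=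
      isPreconnected_connectedComponentIn
    have hlev : ∀ q ∈ connectedComponentIn {q | cubicEval h q = 1} p, q ∈ H ↔ q ∈ O :=
      fun q hq => by
        rw [hHO]
        exact ⟨fun h => h.1, fun h => ⟨h, connectedComponentIn_subset _ _ hq⟩⟩
    have hpc := mem_connectedComponentIn (hsub hp)
    by_contra hne
    obtain ⟨q, hq, hqH⟩ := not_subset.1 hne
    obtain ⟨r, hr, hrO, hrH⟩ := hpre O Hᶜ hO hH.isClosed.isOpen_compl
      (fun r hr => by
        by_cases hrH : r ∈ H
        · exact Or.inl ((hlev r hr).1 hrH)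
        · exact Or.inr hrH) ⟨p, hpc, (hlev p hpc).1 hp⟩ ⟨q, hq, hqH⟩
    exact hrH ((hlev r hr).2 hrO)

theorem exists_equivalent_standardComponent {h : CubicForm (Ambient n)} {H : Set (Ambient n)}
    (hH : IsCCPSR h H) : ∃ h' ∈ generatingSet n, PSREquivalent h H h' (standardComponent h') := by
  obtain ⟨p, hp⟩ := hH.isConnected.nonempty
  have hp1 : cubicEval h p = 1 := by
    obtain ⟨O, -, hHO⟩ := hH.isOpen_in_level
    rw [hHO] at hp
    exact hp.2
  obtain ⟨A, P, hAp, hA⟩ := h.exists_normalForm (hH.hyperbolic_points p hp) hp1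
  let h' : CubicForm (Ambient n) := pullback A.toLinearMap.toContinuousLinearMap h
  have hev : ∀ q, cubicEval h (A q) = cubicEval h' q := fun q => 
    (cubicEval_pullback A.toLinearMap.toContinuousLinearMap h q).symm
  have hs : IsStandardForm h' P := fun x y => by rw [← hev, hA]
  have himage : A '' standardComponent h' = H := by
    rw [hH.eq_connectedComponentIn hp, ← hAp]
    have h1 := A.toContinuousLinearEquiv.toHomeomorph.image_connectedComponentIn
      (s := {q | cubicEval h' q = 1}) (x := (1, 0)) (eval_base hs)
    have h2 : A '' {q | cubicEval h' q = 1} = {q | cubicEval h q = 1} := by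
      ext q
      constructor
      · rintro ⟨q, hq, rfl⟩
        exact (hev q).trans hq
      · intro hq
        refine ⟨A.symm q, ?_, A.apply_symm_apply q⟩
        change cubicEval h' (A.symm q) = 1
        rw [← hev, A.apply_symm_apply]
        exact hq
    rw [← h2]
    exact h1
  refine ⟨h', ⟨P, hs, fun u hu => le_of_isHyperbolicPoint hs (fun q hq => ?_) hu⟩, A, hev, himage⟩
  have hAq : A q ∈ H := himage ▸ mem_image_of_mem A hq
  obtain ⟨h1, h2⟩ := (h.isHyperbolicPoint_iff _).1 (hH.hyperbolic_points _ hAq)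
  have htri := tri_map_of_cubicEval_map A.toLinearMap hev
  refine (h'.isHyperbolicPoint_iff q).2 ⟨hev q ▸ h1, fun v hv hqv => ?_⟩
  have := h2 (A v) (by simpa using hv) ((htri q q v).trans hqv)
  rwa [← htri q v v]

theorem posCone_image (A : Ambient n ≃ₗ[ℝ] Ambient n) (H : Set (Ambient n)) :
    posCone (A '' H) = A '' posCone H := by
  ext q
  constructor
  · rintro ⟨r, hr, _, ⟨p, hp, rfl⟩, rfl⟩
    exact ⟨r • p, ⟨r, hr, p, hp, rfl⟩, map_smul A r p⟩
  · rintro ⟨_, ⟨r, hr, p, hp, rfl⟩, rfl⟩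
    exact ⟨r, hr, A p, mem_image_of_mem A hp, map_smul A r p⟩

/-- The pointwise criteria for regularity involve only the trilinear form and the frontier of the
cone, and A carries both from h' to h. So the dichotomy P(u) = 2/(3√3) for some unit u, or strict
inequality throughout, decides the question. -/
theorem mem_generatingBoundary_iff_not_hasRegularBoundary {h h' : CubicForm (Ambient n)}
    {H : Set (Ambient n)} (hh' : h' ∈ generatingSet n)
    (hequiv : PSREquivalent h H h' (standardComponent h')) :
    h' ∈ generatingBoundary n ↔ ¬ HasRegularBoundary h H := by
  obtain ⟨P, hs, hP⟩ := hh'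
  obtain ⟨A, hev, rfl⟩ := hequiv
  have htri := tri_map_of_cubicEval_map A.toLinearMap hev
  have hfr : frontier (posCone (A '' standardComponent h')) = A '' frontier (standardCone h') := by
    rw [posCone_image, posCone_standardComponent hs hP]
    exact (A.toContinuousLinearEquiv.toHomeomorph.image_frontier _).symm
  rw [mem_generatingBoundary_iff hs hP]
  constructor
  · rintro ⟨u, hu, hPu⟩
    obtain ⟨p, hp, hp0, hpp⟩ := exists_singular_frontier_point hs hP hu hPu
    refine h.not_hasRegularBoundary_of _ (p := A p) (hfr ▸ mem_image_of_mem A hp)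
      (by simpa using hp0) fun v => ?_
    rw [← A.apply_symm_apply v]
    exact (htri p p _).trans (hpp _)
  · intro hreg
    by_contra! hne
    have hlt : ∀ y, ‖y‖ = 1 → cubicEval P y < 2 / (3 * √3) := fun y hy =>
      lt_of_le_of_ne (hP y hy) (hne y hy)
    refine hreg (h.hasRegularBoundary_of _ fun q hq hq0 => ?_)
    rw [hfr] at hq
    obtain ⟨p, hp, rfl⟩ := hq
    have hp0 : p ≠ 0 := by simpa using hq0
    obtain ⟨hx, hle, hp1⟩ := of_mem_frontier_standardCone hs hP hp hp0
    obtain ⟨⟨v, hv⟩, hneg⟩ := regular_at_frontier hs hlt hx hle hp1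
    refine ⟨?_, ⟨A v, fun h0 => hv ((htri p p v).symm.trans h0)⟩, fun w hw => ?_⟩
    · rw [← cubicEval_eq, hev, hp1]
    · rw [← A.apply_symm_apply w] at hw ⊢
      rcases hneg (A.symm w) ((htri p p _).symm.trans hw) with h1 | ⟨t, ht⟩
      · exact Or.inl ((htri p _ _).trans_lt h1)
      · exact Or.inr ⟨t, by rw [ht, map_smul]⟩

end CubicForm

theorem theorem1p1 (n : ℕ) (hn : 1 ≤ n) :
    -- every closed connected PSR manifold is equivalent to one given by an element of `𝒞ₙ`
    (∀ (h : CubicForm (Ambient n)) (H : Set (Ambient n)), IsCCPSR h H →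
      ∃ h' ∈ generatingSet n, PSREquivalent h H h' (standardComponent h')) ∧
    -- every element of `𝒞ₙ` defines a closed connected PSR manifold through `(1, 0)`
    (∀ h ∈ generatingSet n,
      ((1, 0) : Ambient n) ∈ standardComponent h ∧ IsCCPSR h (standardComponent h)) ∧
    -- `𝒞ₙ` is a bounded compact convex subset of an affine space of the stated dimension
    generatingSet n ⊆ (standardSpace n : Set (CubicForm (Ambient n))) ∧
    Module.finrank ℝ (standardSpace n).direction = (n ^ 3 + 3 * n ^ 2 + 2 * n) / 6 ∧
    Bornology.IsBounded (generatingSet n) ∧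
    IsCompact (generatingSet n) ∧
    Convex ℝ (generatingSet n) ∧
    -- `∂𝒞ₙ` is a continuous submanifold of the space of cubics, and a continuous hypersurface
    -- of the affine subspace
    IsTopSubmanifold (CubicForm (Ambient n)) (generatingBoundary n)
      ((n ^ 3 + 3 * n ^ 2 + 2 * n) / 6 - 1) ∧
    IsTopSubmanifold (standardSpace n).direction (frontier (generatingSetIn n))
      ((n ^ 3 + 3 * n ^ 2 + 2 * n) / 6 - 1) ∧
    -- the boundary points correspond to the manifolds without regular boundary behaviour
    (∀ (h : CubicForm (Ambient n)) (H : Set (Ambient n)), IsCCPSR h H →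
      ∀ h' ∈ generatingSet n, PSREquivalent h H h' (standardComponent h') →
        (h' ∈ generatingBoundary n ↔ ¬ HasRegularBoundary h H)) := by
  refine ⟨fun h H hH => CubicForm.exists_equivalent_standardComponent hH, ?_, ?_, ?_,
    (CubicForm.isCompact_generatingSet n).isBounded, CubicForm.isCompact_generatingSet n,
    CubicForm.convex_generatingSet n, CubicForm.isTopSubmanifold_generatingBoundary n,
    CubicForm.isTopSubmanifold_frontier_generatingSetIn n,
    fun h H _ h' hh' hequiv =>
      CubicForm.mem_generatingBoundary_iff_not_hasRegularBoundary hh' hequiv⟩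
  · rintro h ⟨P, hs, hP⟩
    exact ⟨mem_connectedComponentIn (CubicForm.eval_base hs),
      CubicForm.standardComponent_isCCPSR hs hP⟩
  · rintro h ⟨P, hs, -⟩
    exact ⟨P, hs⟩
  · rw [← (CubicForm.directionEquiv n).finrank_eq, CubicForm.finrank_cubicForm]
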